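/- **Model.** Let $r\ge 2$ and let $E\subseteq\{0,\dots,r-1\}^2$ be the edge set of an irreducible and aperiodic directed graph on the $r$ states. Leaving out one outgoing edge per state, a transition matrix that is positive exactly on $E$ is determined by a vector $\mathbf p$ of $d=|E|-r$ transition probabilities; the range $\mathcal R$ consists of the vectors with positive entries such that, for each state, the entries belonging to that state have sum less than $1$. There are users $1,2,3,\dots$; their parameter vectors $\mathbf p_1,\mathbf p_2,\dots$ are drawn independently from a common density on $\mathbb R^d$ that is bounded on $\mathcal R$ and zero off $\mathcal R$. Let $G$ be a graph on the set of users (the association graph) whose connected components (the groups) have uniformly bounded sizes. The data $X_u(k)\in\{0,\dots,r-1\}$ of user $u$ at time $k\in\mathbb N$ satisfy the following, conditionally on almost every realization of the parameter vectors: * for each $u$, $(X_u(k))_k$ is a Markov chain with transition matrix given by $\mathbf p_u$; * for each group, the joint process of the data of its members is stationary and ergodic; * for users $u\ne v$ and all $k$, $I(X_u(k);X_v(k))>0$ if $u$ and $v$ are adjacent in $G$, and $I(X_u(k);X_v(k))=0$ if they are not; * for users $u,v$ of different groups, the sequences $(X_u(k))_k$ and $(X_v(k))_k$ are independent. With $n$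 users and $m=m(n)$ observations per user, let $\Pi$ be a random permutation of $\{1,\dots,n\}$, independent of the parameters and the data, and let $\mathbf Y=(Y_v(k))_{v\le n,\,k\le m}$ with $Y_v(k)=X_{\Pi^{-1}(v)}(k)$ be the anonymized data. An estimator is a measurable function of $(\mathbf p_1,\dots,\mathbf p_n,\mathbf Y)$ with values in $\{0,\dots,r-1\}$. User $u$ has *no privacy* if for every $k$ the infimum of $P(\widetilde{X_u(k)}\ne X_u(k))$ over all estimators $\widetilde{X_u(k)}$ tends to $0$ as $n\to\infty$. **Theorem.** Suppose that the group of user $1$ has size $s$, and that $m=m(n)$ are integers with $m\sim c\,n^{\frac{2}{s(|E|-r)}+\alpha}$ as $n\to\infty$, for some constants $c>0$ and $\alpha>0$. Then user $1$ has no privacy. Moreover, there are estimators of $X_1(k)$, one for each $n$ and $k$, that do not depend on the density, on the joint law of the data or on the law of $\Pi$, and whose error probability tends to $0$ as $n\to\infty$, for every $k$, in every such model. -/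

import Mathlib

open MeasureTheory ProbabilityTheory Filter Topology
open scoped ENNReal

noncomputable section

namespace AnonMarkov

/-! ### The transition graph -/

/-- There is a walk of length `k` from `i` to `l` in the transition graph with edge set `E`. -/
def HasWalk {r : ℕ} (E : Finset (Fin r × Fin r)) : ℕ → Fin r → Fin r → Prop
  | 0, i, l => i = l
  | k + 1, i, l => ∃ j, (i, j) ∈ E ∧ HasWalk E k j l

/-- Every state can be reached from every state. -/
def IsIrreducible {r : ℕ} (E : Finset (Fin r × Fin r)) : Prop :=
  ∀ i l, ∃ k, HasWalk E k i l

/-- For every state, the greatest common divisor of the lengths of its closed walks is one. -/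
def IsAperiodic {r : ℕ} (E : Finset (Fin r × Fin r)) : Prop :=
  ∀ i, ∀ d : ℕ, (∀ k, HasWalk E k i i → d ∣ k) → d = 1

/-- The edges whose probabilities are kept as parameters: in each row `i` the edge `(i, base i)`
is left out, since its probability is determined by the others.
If `(i, base i) ∈ E` for all `i`, there are `|E| - r` of them. -/
abbrev FreeEdge {r : ℕ} (E : Finset (Fin r × Fin r)) (base : Fin r → Fin r) : Type :=
  {e : Fin r × Fin r // e ∈ E ∧ e.2 ≠ base e.1}

/-- The parameter vector of one user. -/
abbrev Param {r : ℕ} (E : Finset (Fin r × Fin r)) (base : Fin r → Fin r) : Type :=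
  FreeEdge E base → ℝ

/-- The parameter vectors of the transition matrices that are positive exactly on `E`. -/
def paramRange {r : ℕ} (E : Finset (Fin r × Fin r)) (base : Fin r → Fin r) :
    Set (Param E base) :=
  {x | (∀ e, 0 < x e) ∧ ∀ i : Fin r, ∑ e : FreeEdge E base with e.1.1 = i, x e < 1}

/-- The transition matrix with parameter vector `x`. -/
def transMatrix {r : ℕ} (E : Finset (Fin r × Fin r)) (base : Fin r → Fin r)
    (x : Param E base) : Matrix (Fin r) (Fin r) ℝ :=
  fun i l =>
    if h : (i, l) ∈ E ∧ l ≠ base i then x ⟨(i, l), h⟩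
    else if l = base i then 1 - ∑ e : FreeEdge E base with e.1.1 = i, x e
    else 0

/-! ### Notions from probability -/

/-- The process `X` is a Markov chain with transition matrix `P` (and any initial law). -/
def IsMarkovChain {Ω S : Type*} [MeasurableSpace Ω] (μ : Measure Ω) (X : ℕ → Ω → S)
    (P : Matrix S S ℝ) : Prop :=
  ∀ (k : ℕ) (a : ℕ → S),
    μ.real {ω | ∀ j ≤ k + 1, X j ω = a j}
      = μ.real {ω | ∀ j ≤ k, X j ω = a j} * P (a k) (a (k + 1))

/-- Mutual information `I(X; Y)`. -/
def mutualInfo {Ω S T : Type*} [MeasurableSpace Ω] [MeasurableSpace S] [MeasurableSpace T]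
    (μ : Measure Ω) (X : Ω → S) (Y : Ω → T) : ℝ≥0∞ :=
  InformationTheory.klDiv (μ.map fun ω => (X ω, Y ω)) ((μ.map X).prod (μ.map Y))

/-- The time shift on sequences. -/
def shift {S : Type*} (y : ℕ → S) : ℕ → S := fun k => y (k + 1)

/-- A probability density of the parameter vector that is bounded and vanishes off the range. -/
structure ParamDensity {r : ℕ} (E : Finset (Fin r × Fin r)) (base : Fin r → Fin r) where
  density : Param E base → ℝ
  measurable_density : Measurable density
  density_nonneg : ∀ x, 0 ≤ density x
  lintegral_density : ∫⁻ x, ENNReal.ofReal (density x) = 1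
  density_bounded : ∃ δ : ℝ, ∀ x ∈ paramRange E base, density x ≤ δ
  density_eq_zero : ∀ x, x ∉ paramRange E base → density x = 0

/-- The law of the parameter vector of one user. -/
def ParamDensity.law {r : ℕ} {E : Finset (Fin r × Fin r)} {base : Fin r → Fin r}
    (f : ParamDensity E base) : Measure (Param E base) :=
  volume.withDensity fun x => ENNReal.ofReal (f.density x)

instance {r : ℕ} {E : Finset (Fin r × Fin r)} {base : Fin r → Fin r}
    (f : ParamDensity E base) : IsProbabilityMeasure f.law :=
  ⟨by simp [ParamDensity.law, f.lintegral_density]⟩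

/-- The law of the parameter vectors of all users, which are independent. -/
def ParamDensity.allLaw {r : ℕ} {E : Finset (Fin r × Fin r)} {base : Fin r → Fin r}
    (f : ParamDensity E base) : Measure (ℕ → Param E base) :=
  Measure.infinitePi fun _ : ℕ => f.law

/-! ### The model -/

/-- The data of all users: `x u k` is the sample of user `u` at time `k` (both counted from `0`).
With `n` users in the system, these are the users `0, …, n - 1`. -/
abbrev Data (r : ℕ) : Type := ℕ → ℕ → Fin r

/-- The Markov chain model with transition graph `E` and association graph `G`. -/
structure MarkovModel {r : ℕ} (E : Finset (Fin r × Fin r)) (base : Fin r → Fin r)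
    (G : SimpleGraph ℕ) where
  /-- The common density of the parameter vectors. -/
  prior : ParamDensity E base
  /-- The conditional law of the data of all users, given the parameter vectors. -/
  dataLaw : Kernel (ℕ → Param E base) (Data r)
  isMarkovKernel_dataLaw : IsMarkovKernel dataLaw
  /-- The trace of each user is a Markov chain with this user's transition matrix. -/
  isMarkovChain : ∀ᵐ p ∂prior.allLaw, ∀ u,
    IsMarkovChain (dataLaw p) (fun k x => x u k) (transMatrix E base (p u))
  /-- The joint process of each group of users is stationary and ergodic. -/
  ergodic : ∀ᵐ p ∂prior.allLaw, ∀ C : G.ConnectedComponent,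
    Ergodic shift ((dataLaw p).map fun x (k : ℕ) (u : C.supp) => x u k)
  /-- Adjacent users have dependent samples, at all times. -/
  mutualInfo_pos : ∀ᵐ p ∂prior.allLaw, ∀ u v, G.Adj u v →
    ∀ k, 0 < mutualInfo (dataLaw p) (fun x => x u k) (fun x => x v k)
  /-- Users that are not adjacent have independent samples, at all times. -/
  mutualInfo_eq_zero : ∀ᵐ p ∂prior.allLaw, ∀ u v, u ≠ v → ¬ G.Adj u v →
    ∀ k, mutualInfo (dataLaw p) (fun x => x u k) (fun x => x v k) = 0
  /-- The traces of two users of different groups are independent. -/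
  indepFun : ∀ᵐ p ∂prior.allLaw, ∀ u v, ¬ G.Reachable u v →
    IndepFun (fun x : Data r => x u) (fun x : Data r => x v) (dataLaw p)

attribute [instance] MarkovModel.isMarkovKernel_dataLaw

/-- The joint law of the parameter vectors and the data of all users. -/
def MarkovModel.law {r : ℕ} {E : Finset (Fin r × Fin r)} {base : Fin r → Fin r}
    {G : SimpleGraph ℕ} (M : MarkovModel E base G) :
    Measure ((ℕ → Param E base) × Data r) :=
  M.prior.allLaw.compProd M.dataLaw

/-! ### Anonymization and the adversary -/

/-- The anonymized version of the first `m` samples of the first `n` users: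
`Y_v(k) = X_{π⁻¹(v)}(k)`. -/
def anonymize {r n : ℕ} (m : ℕ) (π : Equiv.Perm (Fin n)) (x : Data r) : Fin n → Fin m → Fin r :=
  fun v k => x (π.symm v) k

/-- The adversary's estimators of one sample, from the parameter vectors of the `n` users
and `m` anonymized observations per user. -/
def Estimator {r : ℕ} (E : Finset (Fin r × Fin r)) (base : Fin r → Fin r) (n m : ℕ) : Type :=
  {A : (Fin n → Param E base) × (Fin n → Fin m → Fin r) → Fin r // Measurable A}

/-- The probability that the estimator `A` of the sample of user `u` at time `k` is wrong, when the
permutation has law `τ` and is independent of the parameters and the data. -/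
def errorProb {r : ℕ} {E : Finset (Fin r × Fin r)} {base : Fin r → Fin r} {G : SimpleGraph ℕ}
    (M : MarkovModel E base G) {n m : ℕ} (τ : PMF (Equiv.Perm (Fin n)))
    (u k : ℕ) (A : Estimator E base n m) : ℝ≥0∞ :=
  ∑ π : Equiv.Perm (Fin n),
    τ π * M.law {ω | A.1 (fun v : Fin n => ω.1 v, anonymize m π ω.2) ≠ ω.2 u k}

/-- User `u` has no privacy: at all times, the least error probability tends to zero as the number
of users `n` grows, where `m n` is the number of observations per user and `τ n` is the law of the
permutation. -/
def NoPrivacy {r : ℕ} {E : Finset (Fin r × Fin r)} {base : Fin r → Fin r} {G : SimpleGraph ℕ}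
    (M : MarkovModel E base G) (m : ℕ → ℕ) (τ : (n : ℕ) → PMF (Equiv.Perm (Fin n)))
    (u : ℕ) : Prop :=
  ∀ k : ℕ, Tendsto (fun n => ⨅ A : Estimator E base n (m n), errorProb M (τ n) u k A) atTop (𝓝 0)

end AnonMarkov

end

/-! The adversary looks for an injective placement of the target user's group among the `n`
pseudonyms that passes two kinds of tests: each trace must fit the transition matrix of the user
placed on it and visit every state often, and the traces of adjacent users must look dependent. The
estimate is read off any passing placement. It can be wrong only if the true placement fails a test,
or if a placement that misplaces the target passes all of them (`mem_failure_of_groupEstimate_ne`).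

The true placement passes with probability tending to one: transition counts deviate from their
compensators by little more than `√M` (`IsMarkovChain.measureReal_trans_sub_occ_le`), and the mean
ergodic theorem supplies the visits and the dependence (`tendsto_measure_not_passes`).

For false placements, the deviation bound is free of the transition matrix, so it holds at once for
all `n` users and for all pairs of users from different groups. A trace that fits a wrong user then
forces the two parameter vectors within `ε`, of order `M ^ (-1/2 + 2δ)` (`RowTest.abs_sub_le`). If
adjacent members were placed on users of different groups, the pair of traces would be nearly a
chain with the product matrix of the two true members. That matrix is primitive, so the joint
occupation would be close to a product and the dependence test would fail (`not_depTest`). The group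
being connected, its whole image lies in one group (`reachable_of_forall_adj`).

This leaves only `O(n)` placements outside the group, instead of `n ^ s`. Each of them needs `s`
independent coincidences of probability `O(ε ^ d)`, with `d = |E| - r`, and `n * ε ^ (s * d)` tends
to zero exactly because of the excess `α`. Placements that keep the target inside its own group cost
one coincidence, and there are boundedly many choices for it (`allLaw_closeGroups_le`). The
statements for given parameters are integrated by dominated convergence
(`MarkovModel.tendsto_law_failure`). -/

noncomputable section

namespace AnonMarkov

/-! ### Deviation bounds for the transition counts of a finite Markov chain -/

section Counts

variable {S : Type*} [DecidableEq S]

/-- The number of visits of the sequence `y` to `a` before time `M`. -/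
def occ (M : ℕ) (y : ℕ → S) (a : S) : ℝ :=
  ∑ t ∈ Finset.range M, if y t = a then 1 else 0

/-- The number of transitions of the sequence `y` from `a` to `b` that start before time `M`. -/
def trans (M : ℕ) (y : ℕ → S) (a b : S) : ℝ :=
  ∑ t ∈ Finset.range M, if y t = a ∧ y (t + 1) = b then 1 else 0

lemma occ_nonneg (M : ℕ) (y : ℕ → S) (a : S) : 0 ≤ occ M y a :=
  Finset.sum_nonneg fun _ _ => by split_ifs <;> simp

lemma occ_congr {M : ℕ} {y z : ℕ → S} (h : ∀ t < M, y t = z t) (a : S) :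
    occ M y a = occ M z a :=
  Finset.sum_congr rfl fun t ht => by rw [h t (Finset.mem_range.1 ht)]

lemma trans_congr {M : ℕ} {y z : ℕ → S} (h : ∀ t < M + 1, y t = z t) (a b : S) :
    trans M y a b = trans M z a b :=
  Finset.sum_congr rfl fun t ht => by
    have := Finset.mem_range.1 ht
    rw [h t (by omega), h (t + 1) (by omega)]

lemma sum_occ [Fintype S] (M : ℕ) (y : ℕ → S) : ∑ a, occ M y a = M := by
  unfold occ
  rw [Finset.sum_comm]
  simp

/-- Arrivals at `b` are visits to `b` in a window shifted by one, so only the two ends differ. This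
is the source of approximate invariance in `abs_occ_sub_sum_le`. -/
lemma sum_trans_left [Fintype S] (M : ℕ) (y : ℕ → S) (b : S) :
    ∑ a, trans M y a b = occ M y b + (if y M = b then 1 else 0) - (if y 0 = b then 1 else 0) := by
  unfold occ trans
  rw [Finset.sum_comm]
  have h : ∀ t, (∑ a, if y t = a ∧ y (t + 1) = b then (1 : ℝ) else 0)
      = if y (t + 1) = b then 1 else 0 := by
    intro t
    by_cases hb : y (t + 1) = b <;> simp [hb]
  simp_rw [h]
  have h1 := Finset.sum_range_succ (fun t => if y t = b then (1 : ℝ) else 0) M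
  have h2 := Finset.sum_range_succ' (fun t => if y t = b then (1 : ℝ) else 0) M
  linarith

end Counts

/-! ### Exponential moments along paths and the Chernoff bound. -/

section Deviation

variable {Ω S : Type*} [MeasurableSpace Ω] {μ : Measure Ω} {X : ℕ → Ω → S} {Q : Matrix S S ℝ}

/-- The sequence that follows the path `c` and stays at its last state. -/
def extendPath {k : ℕ} (c : Fin (k + 1) → S) (j : ℕ) : S := c ⟨min j k, by omega⟩

lemma extendPath_snoc_of_le {k : ℕ} (c : Fin (k + 1) → S) (b : S) {j : ℕ} (hj : j ≤ k) :
    extendPath (Fin.snoc c b : Fin (k + 2) → S) j = extendPath c j := by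
  unfold extendPath
  have : (⟨min j (k + 1), by omega⟩ : Fin (k + 2)) = Fin.castSucc ⟨min j k, by omega⟩ := by
    ext; simp; omega
  rw [this, Fin.snoc_castSucc]

lemma extendPath_snoc_last {k : ℕ} (c : Fin (k + 1) → S) (b : S) :
    extendPath (Fin.snoc c b : Fin (k + 2) → S) (k + 1) = b := by
  unfold extendPath
  have : (⟨min (k + 1) (k + 1), by omega⟩ : Fin (k + 2)) = Fin.last (k + 1) := by
    ext; simp
  rw [this, Fin.snoc_last]

lemma extendPath_eq {k : ℕ} (y : ℕ → S) {j : ℕ} (hj : j ≤ k) :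
    extendPath (fun i : Fin (k + 1) => y i) j = y j := by
  simp [extendPath, hj]

/-- The Markov property splits off the last step of a path, which contributes a factor of at most
`B` whatever the state before it. Summing over finitely many paths takes the place of conditional
expectations. -/
lemma IsMarkovChain.sum_path_exp_le [Fintype S] [MeasurableSpace S] [MeasurableSingletonClass S]
    [IsProbabilityMeasure μ] (hX : IsMarkovChain μ X Q) (hmeas : ∀ k, Measurable (X k))
    {h : S → S → ℝ} {B : ℝ} (hB : 0 ≤ B)
    (hQ : ∀ a, ∑ b, Q a b * Real.exp (h a b) ≤ B) (k : ℕ) :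
    ∑ c : Fin (k + 1) → S, μ.real {ω | ∀ j ≤ k, X j ω = extendPath c j} *
      Real.exp (∑ t ∈ Finset.range k, h (extendPath c t) (extendPath c (t + 1))) ≤ B ^ k := by
  induction k with
  | zero =>
    rw [← (Equiv.funUnique (Fin 1) S).symm.sum_comp]
    simp only [Finset.range_zero, Finset.sum_empty, Real.exp_zero, mul_one, pow_zero,
      Nat.le_zero, forall_eq]
    have : ∀ a : S, {ω | X 0 ω = extendPath ((Equiv.funUnique (Fin 1) S).symm a) 0} = X 0 ⁻¹' {a} := by
      intro a; ext ω; simp [extendPath]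
    simp_rw [this]
    rw [sum_measureReal_preimage_singleton _ fun a _ => hmeas 0 (measurableSet_singleton a)]
    exact measureReal_le_one
  | succ k ih =>
    rw [← (Fin.snocEquiv (fun _ : Fin (k + 2) => S)).sum_comp, Fintype.sum_prod_type_right]
    calc _ = ∑ c : Fin (k + 1) → S, (μ.real {ω | ∀ j ≤ k, X j ω = extendPath c j} *
          Real.exp (∑ t ∈ Finset.range k, h (extendPath c t) (extendPath c (t + 1)))) *
          ∑ b, Q (extendPath c k) b * Real.exp (h (extendPath c k) b) := by
          refine Finset.sum_congr rfl fun c _ => ?_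
          rw [Finset.mul_sum]
          refine Finset.sum_congr rfl fun b _ => ?_
          change μ.real {ω | ∀ j ≤ k + 1, X j ω =
            extendPath (Fin.snoc c b : Fin (k + 2) → S) j} * Real.exp (∑ t ∈ Finset.range (k + 1),
              h (extendPath (Fin.snoc c b : Fin (k + 2) → S) t)
                (extendPath (Fin.snoc c b : Fin (k + 2) → S) (t + 1))) = _
          rw [hX k, extendPath_snoc_last, extendPath_snoc_of_le c b le_rfl, Finset.sum_range_succ,
            extendPath_snoc_last, extendPath_snoc_of_le c b le_rfl, Real.exp_add]
          have h1 : {ω | ∀ j ≤ k, X j ω = extendPath (Fin.snoc c b : Fin (k + 2) → S) j} =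
              {ω | ∀ j ≤ k, X j ω = extendPath c j} := by
            ext ω
            refine forall_congr' fun j => forall_congr' fun hj => ?_
            rw [extendPath_snoc_of_le c b hj]
          have h2 : ∑ t ∈ Finset.range k, h (extendPath (Fin.snoc c b : Fin (k + 2) → S) t)
                (extendPath (Fin.snoc c b : Fin (k + 2) → S) (t + 1)) =
              ∑ t ∈ Finset.range k, h (extendPath c t) (extendPath c (t + 1)) := by
            refine Finset.sum_congr rfl fun t ht => ?_
            have := Finset.mem_range.1 ht
            rw [extendPath_snoc_of_le c b (by omega), extendPath_snoc_of_le c b (by omega)]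
          rw [h1, h2]
          ring
      _ ≤ ∑ c : Fin (k + 1) → S, (μ.real {ω | ∀ j ≤ k, X j ω = extendPath c j} *
          Real.exp (∑ t ∈ Finset.range k, h (extendPath c t) (extendPath c (t + 1)))) * B := by
          gcongr with c
          exact hQ _
      _ ≤ B ^ k * B := by
          rw [← Finset.sum_mul]
          gcongr
      _ = B ^ (k + 1) := by ring

/-- Chernoff's argument: on a path whose sum is at least `l`, the weight `exp (-l) * exp (sum)` is
at least one, so the exponential moment over paths bounds the total probability. -/
lemma IsMarkovChain.measureReal_sum_ge_le [Fintype S] [MeasurableSpace S]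
    [MeasurableSingletonClass S]
    [IsProbabilityMeasure μ] (hX : IsMarkovChain μ X Q) (hmeas : ∀ k, Measurable (X k))
    {h : S → S → ℝ} {B : ℝ} (hB : 0 ≤ B)
    (hQ : ∀ a, ∑ b, Q a b * Real.exp (h a b) ≤ B) (k : ℕ) (l : ℝ) :
    μ.real {ω | l ≤ ∑ t ∈ Finset.range k, h (X t ω) (X (t + 1) ω)} ≤ Real.exp (-l) * B ^ k := by
  classical
  set T : Finset (Fin (k + 1) → S) := Finset.univ.filter fun c =>
    l ≤ ∑ t ∈ Finset.range k, h (extendPath c t) (extendPath c (t + 1)) with hT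
  have hsub : {ω | l ≤ ∑ t ∈ Finset.range k, h (X t ω) (X (t + 1) ω)} ⊆
      ⋃ c ∈ T, {ω | ∀ j ≤ k, X j ω = extendPath c j} := by
    intro ω hω
    simp only [Set.mem_iUnion, Set.mem_ofPred_eq, exists_prop]
    refine ⟨fun i => X i ω, ?_, fun j hj => (extendPath_eq (fun j => X j ω) hj).symm⟩
    rw [hT, Finset.mem_filter]
    refine ⟨Finset.mem_univ _, le_trans hω (le_of_eq ?_)⟩
    refine Finset.sum_congr rfl fun t ht => ?_
    have := Finset.mem_range.1 ht
    rw [extendPath_eq (fun j => X j ω) (by omega), extendPath_eq (fun j => X j ω) (by omega)]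
  calc _ ≤ μ.real (⋃ c ∈ T, {ω | ∀ j ≤ k, X j ω = extendPath c j}) :=
        measureReal_mono hsub (measure_ne_top _ _)
    _ ≤ ∑ c ∈ T, μ.real {ω | ∀ j ≤ k, X j ω = extendPath c j} :=
        measureReal_biUnion_finset_le _ _
    _ ≤ ∑ c ∈ T, Real.exp (-l) * (μ.real {ω | ∀ j ≤ k, X j ω = extendPath c j} *
      Real.exp (∑ t ∈ Finset.range k, h (extendPath c t) (extendPath c (t + 1)))) := by
        refine Finset.sum_le_sum fun c hc => ?_
        have h1 := (Finset.mem_filter.1 hc).2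
        have h2 : 1 ≤ Real.exp (-l) *
            Real.exp (∑ t ∈ Finset.range k, h (extendPath c t) (extendPath c (t + 1))) := by
          rw [← Real.exp_add]
          exact Real.one_le_exp (by linarith)
        calc μ.real {ω | ∀ j ≤ k, X j ω = extendPath c j}
            ≤ μ.real {ω | ∀ j ≤ k, X j ω = extendPath c j} * (Real.exp (-l) *
            Real.exp (∑ t ∈ Finset.range k, h (extendPath c t) (extendPath c (t + 1)))) :=
              le_mul_of_one_le_right measureReal_nonneg h2
          _ = _ := by ring
    _ ≤ ∑ c, Real.exp (-l) * (μ.real {ω | ∀ j ≤ k, X j ω = extendPath c j} *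
      Real.exp (∑ t ∈ Finset.range k, h (extendPath c t) (extendPath c (t + 1)))) :=
        Finset.sum_le_sum_of_subset_of_nonneg (Finset.subset_univ _) fun _ _ _ => by positivity
    _ ≤ Real.exp (-l) * B ^ k := by
        rw [← Finset.mul_sum]
        gcongr
        exact hX.sum_path_exp_le hmeas hB hQ k

/-- A transition matrix: nonnegative entries and row sums one. -/
structure IsStochastic [Fintype S] (Q : Matrix S S ℝ) : Prop where
  nonneg : ∀ a b, 0 ≤ Q a b
  row_sum : ∀ a, ∑ b, Q a b = 1

lemma IsStochastic.le_one [Fintype S] (hQ : IsStochastic Q) (a b : S) : Q a b ≤ 1 := by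
  rw [← hQ.row_sum a]
  exact Finset.single_le_sum (fun b _ => hQ.nonneg a b) (Finset.mem_univ b)

/-- For `x = a` the exponent `z` is `θ` times a centred variable of modulus at most one; in `exp z ≤
1 + z + z ^ 2` the linear term has mean zero. For `x ≠ a` the exponent vanishes. -/
lemma IsStochastic.sum_exp_le [Fintype S] [DecidableEq S] (hQ : IsStochastic Q) (a b x : S) {θ : ℝ}
    (hθ : |θ| ≤ 1) :
    ∑ y, Q x y * Real.exp (θ * ((if x = a ∧ y = b then 1 else 0) - (if x = a then Q a b else 0)))
      ≤ 1 + θ ^ 2 := by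
  by_cases hx : x = a
  swap
  · simp [hx, hQ.row_sum, sq_nonneg]
  subst hx
  simp only [true_and, if_true]
  have hb0 := hQ.nonneg x b
  have hb1 := hQ.le_one x b
  have key : ∀ y, Real.exp (θ * ((if y = b then 1 else 0) - Q x b)) ≤
      1 + θ * ((if y = b then 1 else 0) - Q x b) + θ ^ 2 := by
    intro y
    set z : ℝ := (if y = b then 1 else 0) - Q x b with hz
    have hz1 : |z| ≤ 1 := by
      rw [hz, abs_le]; split_ifs <;> constructor <;> linarith
    have hz2 : |θ * z| ≤ 1 := by
      rw [abs_mul]; exact mul_le_one₀ hθ (abs_nonneg _) hz1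
    have h1 := Real.abs_exp_sub_one_sub_id_le hz2
    have h2 := (abs_le.1 h1).2
    have h3 : z ^ 2 ≤ 1 := by rw [← sq_abs]; exact pow_le_one₀ (abs_nonneg _) hz1
    have h4 : θ ^ 2 * z ^ 2 ≤ θ ^ 2 := mul_le_of_le_one_right (sq_nonneg _) h3
    have h5 : (θ * z) ^ 2 = θ ^ 2 * z ^ 2 := by ring
    linarith
  calc _ ≤ ∑ y, Q x y * (1 + θ * ((if y = b then 1 else 0) - Q x b) + θ ^ 2) := by
        gcongr with y
        · exact hQ.nonneg x y
        · exact key y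
    _ = ∑ y, (Q x y * (1 + θ ^ 2 - θ * Q x b) + θ * (if y = b then Q x y else 0)) := by
        refine Finset.sum_congr rfl fun y _ => ?_
        split_ifs <;> ring
    _ = 1 + θ ^ 2 := by
        rw [Finset.sum_add_distrib, ← Finset.sum_mul, ← Finset.mul_sum, hQ.row_sum]
        simp

/-- The transition counts of a Markov chain concentrate around their compensators, at a rate that
does not depend on the chain. -/
theorem IsMarkovChain.measureReal_trans_sub_occ_le [Fintype S] [DecidableEq S] [MeasurableSpace S]
    [MeasurableSingletonClass S] [IsProbabilityMeasure μ] (hX : IsMarkovChain μ X Q)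
    (hmeas : ∀ k, Measurable (X k)) (hQ : IsStochastic Q) (a b : S) {M : ℕ} (hM : 0 < M) (l : ℝ) :
    μ.real {ω | l < |trans M (fun t => X t ω) a b - occ M (fun t => X t ω) a * Q a b|}
      ≤ 2 * Real.exp (1 - l / √M) := by
  have hM' : (1 : ℝ) ≤ M := by exact_mod_cast hM
  have hsq : (1 : ℝ) ≤ √M := by simpa using Real.sqrt_le_sqrt hM'
  -- The tilt `σ / √M` keeps the moment factor `(1 + 1 / M) ^ M` below `e`; the two signs of `σ`
  -- give the two tails.
  have hone : ∀ σ : ℝ, |σ| = 1 →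
      μ.real {ω | l / √M ≤ ∑ t ∈ Finset.range M, (σ / √M) *
        ((if X t ω = a ∧ X (t + 1) ω = b then 1 else 0) - (if X t ω = a then Q a b else 0))}
        ≤ Real.exp (1 - l / √M) := by
    intro σ hσ
    have hθ : |σ / √M| ≤ 1 := by
      rw [abs_div, hσ, abs_of_pos (by linarith)]
      exact div_le_one_of_le₀ hsq (by linarith)
    have hθ2 : (σ / √M) ^ 2 = 1 / M := by
      rw [div_pow, ← sq_abs, hσ, Real.sq_sqrt (by linarith)]; norm_num
    have h1 := hX.measureReal_sum_ge_le hmeas (h := fun x y => (σ / √M) *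
      ((if x = a ∧ y = b then 1 else 0) - (if x = a then Q a b else 0)))
      (B := 1 + (σ / √M) ^ 2) (by positivity) (fun x => hQ.sum_exp_le a b x hθ) M (l / √M)
    refine h1.trans ?_
    have h2 : (1 + (σ / √M) ^ 2) ^ M ≤ Real.exp 1 := by
      rw [hθ2]
      calc (1 + 1 / (M : ℝ)) ^ M ≤ Real.exp (1 / M) ^ M := by
            gcongr
            rw [add_comm]; exact Real.add_one_le_exp _
        _ = Real.exp 1 := by
            rw [← Real.exp_nat_mul]; congr 1; field_simp
    calc _ ≤ Real.exp (-(l / √M)) * Real.exp 1 := by gcongr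
      _ = _ := by rw [← Real.exp_add]; congr 1; ring
  have hsum : ∀ (σ : ℝ) (ω : Ω), ∑ t ∈ Finset.range M, (σ / √M) *
        ((if X t ω = a ∧ X (t + 1) ω = b then 1 else 0) - (if X t ω = a then Q a b else 0))
      = σ * (trans M (fun t => X t ω) a b - occ M (fun t => X t ω) a * Q a b) / √M := by
    intro σ ω
    rw [← Finset.mul_sum, Finset.sum_sub_distrib]
    have : ∀ t, (if X t ω = a then Q a b else 0) = (if X t ω = a then 1 else 0) * Q a b := by
      intro t; split_ifs <;> simp
    simp_rw [this]
    rw [← Finset.sum_mul]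
    unfold trans occ
    ring
  have h1 := hone 1 (by simp)
  have h2 := hone (-1) (by simp)
  simp_rw [hsum] at h1 h2
  calc _ ≤ μ.real ({ω | l / √M ≤ 1 * (trans M (fun t => X t ω) a b
            - occ M (fun t => X t ω) a * Q a b) / √M} ∪
          {ω | l / √M ≤ -1 * (trans M (fun t => X t ω) a b
            - occ M (fun t => X t ω) a * Q a b) / √M}) := by
        refine measureReal_mono ?_
        intro ω hω
        rcases lt_abs.1 (Set.mem_ofPred_eq ▸ hω) with h | h
        · left
          simp only [Set.mem_ofPred_eq]
          gcongr
          linarith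
        · right
          simp only [Set.mem_ofPred_eq]
          gcongr
          linarith
    _ ≤ _ := measureReal_union_le _ _
    _ ≤ _ := by linarith

end Deviation

/-! ### Walks in the transition graph -/

section Walks

variable {r : ℕ} {E : Finset (Fin r × Fin r)}

lemma HasWalk.append {k k' : ℕ} {i j l : Fin r} (h : HasWalk E k i j) (h' : HasWalk E k' j l) :
    HasWalk E (k + k') i l := by
  induction k generalizing i with
  | zero => cases h; simpa using h'
  | succ k ih =>
    obtain ⟨x, hx, hw⟩ := h
    rw [Nat.add_right_comm]
    exact ⟨x, hx, ih hw⟩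

/-- In an irreducible aperiodic graph, all states are joined by walks of one common length. -/
lemma exists_forall_hasWalk (hirr : IsIrreducible E) (haper : IsAperiodic E) :
    ∃ N, ∀ i l, HasWalk E N i l := by
  rcases isEmpty_or_nonempty (Fin r) with hr | ⟨⟨o⟩⟩
  · exact ⟨0, fun i => hr.elim i⟩
  -- Closed walks at `o` concatenate, so their lengths form a numerical semigroup; as its gcd is
  -- one, it contains all large numbers. Two states are then joined through `o`, and the length of
  -- the closed walk there evens out the total.
  let A : AddSubmonoid ℕ :=
    { carrier := {k | HasWalk E k o o}
      zero_mem' := rfl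
      add_mem' := fun ha hb => HasWalk.append ha hb }
  have hgcd : Nat.setGcd (A : Set ℕ) = 1 := haper o _ fun k hk => Nat.setGcd_dvd_of_mem hk
  obtain ⟨n₀, hn₀⟩ := Nat.exists_mem_closure_of_ge (A : Set ℕ)
  have hA : ∀ k ≥ n₀, HasWalk E k o o := by
    intro k hk
    have := hn₀ k hk (by rw [hgcd]; exact one_dvd k)
    rwa [AddSubmonoid.closure_eq] at this
  choose f hf using hirr
  obtain ⟨B, hB⟩ : ∃ B, ∀ i l, f i l ≤ B := by
    refine ⟨∑ i, ∑ l, f i l, fun i l => ?_⟩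
    exact (Finset.single_le_sum (fun _ _ => Nat.zero_le _) (Finset.mem_univ l)).trans
      (Finset.single_le_sum (f := fun i => ∑ l, f i l) (fun _ _ => Nat.zero_le _)
        (Finset.mem_univ i))
  refine ⟨n₀ + B + B, fun i l => ?_⟩
  have h1 := hB i o
  have h2 := hB o l
  have := ((hf i o).append (hA (n₀ + B + B - f i o - f o l) (by omega))).append (hf o l)
  convert this using 1
  omega

/-- An irreducible aperiodic graph on at least two states has more edges than states. -/
lemma card_lt_card_of_isAperiodic (hr : 2 ≤ r) (hirr : IsIrreducible E) (haper : IsAperiodic E)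
    {base : Fin r → Fin r} (hbase : ∀ i, (i, base i) ∈ E) : r < E.card := by
  classical
  set B : Finset (Fin r × Fin r) := Finset.univ.image fun i => (i, base i) with hB
  have hBE : B ⊆ E := by
    intro e he
    obtain ⟨i, -, rfl⟩ := Finset.mem_image.1 he
    exact hbase i
  have hBcard : B.card = r := by
    rw [hB, Finset.card_image_of_injective _ fun i j h => congrArg Prod.fst h]
    simp
  rcases (Finset.card_le_card hBE).lt_or_eq with h | h
  · rwa [hBcard] at h
  exfalso
  -- With only `r` edges, `E` is the graph of the map `base` and walks are its iterates.
  -- Aperiodicity makes `o` a fixed point, from which no other state is reached.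
  have hEB := (Finset.eq_of_subset_of_card_le hBE h.ge).symm
  have hedge : ∀ i j, (i, j) ∈ E → j = base i := by
    intro i j hij
    rw [hEB, hB] at hij
    obtain ⟨x, -, hx⟩ := Finset.mem_image.1 hij
    obtain ⟨rfl, rfl⟩ := Prod.mk.inj hx
    rfl
  have hwalk : ∀ k i l, HasWalk E k i l → base^[k] i = l := by
    intro k
    induction k with
    | zero => intro i l h; exact h
    | succ k ih =>
      rintro i l ⟨j, hj, hw⟩
      rw [Function.iterate_succ_apply, ← hedge i j hj]
      exact ih j l hw
  let o : Fin r := ⟨0, by omega⟩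
  have hper : Function.minimalPeriod base o = 1 :=
    haper o _ fun k hk => Function.IsPeriodicPt.minimalPeriod_dvd (hwalk k o o hk)
  have hfix : Function.IsFixedPt base o := Function.minimalPeriod_eq_one_iff_isFixedPt.1 hper
  obtain ⟨k, hk⟩ := hirr o ⟨1, by omega⟩
  have h1 := hwalk k _ _ hk
  rw [hfix.iterate k] at h1
  exact absurd (congrArg Fin.val h1) (by simp [o])

lemma card_freeEdge {base : Fin r → Fin r} (hbase : ∀ i, (i, base i) ∈ E) :
    Fintype.card (FreeEdge E base) + r = E.card := by
  classical
  have h1 : Fintype.card (FreeEdge E base) = (E.filter fun e => e.2 ≠ base e.1).card := by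
    rw [Fintype.card_subtype]
    congr 1
    ext e; simp
  have h2 : (E.filter fun e => ¬ e.2 ≠ base e.1).card = r := by
    have : (E.filter fun e => ¬ e.2 ≠ base e.1) = Finset.univ.image fun i => (i, base i) := by
      ext ⟨i, j⟩
      simp only [ne_eq, not_not, Finset.mem_filter, Finset.mem_image, Finset.mem_univ, true_and,
        Prod.mk.injEq]
      constructor
      · rintro ⟨-, rfl⟩; exact ⟨i, rfl, rfl⟩
      · rintro ⟨x, rfl, rfl⟩; exact ⟨hbase x, rfl⟩
    rw [this, Finset.card_image_of_injective _ fun i j h => congrArg Prod.fst h]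
    simp
  have h3 := Finset.card_filter_add_card_filter_not (s := E) fun e => e.2 ≠ base e.1
  rw [h1]
  omega

end Walks

/-! ### The transition matrices of the model -/

section TransMatrix

variable {r : ℕ} {E : Finset (Fin r × Fin r)} {base : Fin r → Fin r} {x : Param E base}

lemma transMatrix_freeEdge (x : Param E base) (e : FreeEdge E base) :
    transMatrix E base x e.1.1 e.1.2 = x e := by
  simp [transMatrix, e.2.1, e.2.2]

lemma sum_transMatrix (x : Param E base) (i : Fin r) : ∑ l, transMatrix E base x i l = 1 := by
  classical
  rw [← Finset.add_sum_erase _ _ (Finset.mem_univ (base i))]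
  have h1 : transMatrix E base x i (base i)
      = 1 - ∑ e : FreeEdge E base with e.1.1 = i, x e := by simp [transMatrix]
  have h2 : ∑ l ∈ Finset.univ.erase (base i), transMatrix E base x i l
      = ∑ e : FreeEdge E base with e.1.1 = i, x e := by
    symm
    refine Finset.sum_of_injOn (fun e => e.1.2) ?_ ?_ ?_ ?_
    · intro e he e' he' h
      have he := (Finset.mem_filter.1 he).2
      have he' := (Finset.mem_filter.1 he').2
      exact Subtype.ext (Prod.ext (he.trans he'.symm) h)
    · intro e he
      have he := (Finset.mem_filter.1 he).2
      subst he
      simpa using e.2.2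
    · intro l hl hl'
      have hl1 : l ≠ base i := Finset.ne_of_mem_erase hl
      have : ¬ ((i, l) ∈ E ∧ l ≠ base i) := by
        intro h
        exact hl' ⟨⟨(i, l), h⟩, by simp, rfl⟩
      simp only [transMatrix, dif_neg this, if_neg hl1]
    · intro e he
      have he := (Finset.mem_filter.1 he).2
      subst he
      exact (transMatrix_freeEdge x e).symm
  rw [h1, h2]
  ring

lemma isStochastic_transMatrix (hx : x ∈ paramRange E base) :
    IsStochastic (transMatrix E base x) where
  nonneg i l := by
    unfold transMatrix
    split_ifs
    · exact (hx.1 _).le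
    · linarith [hx.2 i]
    · exact le_rfl
  row_sum := sum_transMatrix x

lemma transMatrix_pos (hx : x ∈ paramRange E base) {i l : Fin r} (h : (i, l) ∈ E) :
    0 < transMatrix E base x i l := by
  unfold transMatrix
  split_ifs with h1 h2
  · exact hx.1 _
  · linarith [hx.2 i]
  · exact absurd ⟨h, h2⟩ h1

lemma HasWalk.transMatrix_pow_pos (hx : x ∈ paramRange E base) {k : ℕ} {i l : Fin r}
    (h : HasWalk E k i l) : 0 < (transMatrix E base x ^ k) i l := by
  have hnn : ∀ k i l, 0 ≤ (transMatrix E base x ^ k) i l := by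
    intro k
    induction k with
    | zero => intro i l; simp only [pow_zero, Matrix.one_apply]; split_ifs <;> simp
    | succ k ih =>
      intro i l
      rw [pow_succ, Matrix.mul_apply]
      exact Finset.sum_nonneg fun j _ =>
        mul_nonneg (ih i j) ((isStochastic_transMatrix hx).nonneg j l)
  induction k generalizing i with
  | zero => cases h; simp
  | succ k ih =>
    obtain ⟨j, hj, hw⟩ := h
    rw [pow_succ', Matrix.mul_apply]
    exact Finset.sum_pos' (fun j _ => mul_nonneg ((isStochastic_transMatrix hx).nonneg i j)
      (hnn k j l)) ⟨j, Finset.mem_univ j, mul_pos (transMatrix_pos hx hj) (ih hw)⟩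

lemma dist_le_of_transMatrix {x y : Param E base} {ε : ℝ} (hε : 0 ≤ ε)
    (h : ∀ i l, |transMatrix E base x i l - transMatrix E base y i l| ≤ ε) : dist x y ≤ ε := by
  rw [dist_pi_le_iff hε]
  intro e
  have := h e.1.1 e.1.2
  rwa [transMatrix_freeEdge, transMatrix_freeEdge] at this

lemma measurable_transMatrix (i l : Fin r) :
    Measurable fun x : Param E base => transMatrix E base x i l := by
  unfold transMatrix
  split_ifs
  · exact measurable_pi_apply _
  · exact measurable_const.sub (Finset.measurable_sum _ fun e _ => measurable_pi_apply e)
  · exact measurable_const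

end TransMatrix

/-! ### Approximately stationary vectors -/

section Stationary

variable {S : Type*} [Fintype S]

/-- A nonzero vector of sum zero has entries of both signs. Positive matrix entries make them cancel
in every column, so multiplication by `Q` strictly lowers the sum of absolute values. -/
lemma eq_zero_of_vecMul_eq_self {Q : Matrix S S ℝ} (hrow : ∀ a, ∑ b, Q a b = 1)
    (hpos : ∀ a b, 0 < Q a b) {ν : S → ℝ} (hν : Matrix.vecMul ν Q = ν) (hsum : ∑ a, ν a = 0) :
    ν = 0 := by
  by_contra hne
  obtain ⟨a₀, ha₀⟩ : ∃ a, ν a ≠ 0 := Function.ne_iff.1 hne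
  obtain ⟨a₁, ha₁⟩ : ∃ a, 0 < ν a := by
    by_contra! h
    exact ha₀ ((Finset.sum_eq_zero_iff_of_nonpos fun a _ => h a).1 hsum a₀ (Finset.mem_univ _))
  obtain ⟨a₂, ha₂⟩ : ∃ a, ν a < 0 := by
    by_contra! h
    exact ha₀ ((Finset.sum_eq_zero_iff_of_nonneg fun a _ => h a).1 hsum a₀ (Finset.mem_univ _))
  have hlt : ∀ b, |ν b| < ∑ a, |ν a| * Q a b := by
    intro b
    have hb : ν b = ∑ a, ν a * Q a b := (congrFun hν b).symm
    rw [abs_lt]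
    constructor
    · rw [hb, ← sub_pos, sub_neg_eq_add, ← Finset.sum_add_distrib]
      refine Finset.sum_pos' (fun a _ => ?_) ⟨a₁, Finset.mem_univ _, ?_⟩
      · have := neg_abs_le (ν a)
        nlinarith [(hpos a b).le]
      · have := hpos a₁ b
        positivity
    · rw [hb, ← sub_pos, ← Finset.sum_sub_distrib]
      refine Finset.sum_pos' (fun a _ => ?_) ⟨a₂, Finset.mem_univ _, ?_⟩
      · have := le_abs_self (ν a)
        nlinarith [(hpos a b).le]
      · have := hpos a₂ b
        rw [← sub_mul]
        exact mul_pos (by linarith [abs_pos.2 ha₂.ne]) this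
  have h1 : ∑ b, |ν b| < ∑ b, ∑ a, |ν a| * Q a b :=
    Finset.sum_lt_sum (fun b _ => (hlt b).le) ⟨a₀, Finset.mem_univ _, hlt a₀⟩
  rw [Finset.sum_comm] at h1
  simp_rw [← Finset.mul_sum, hrow, mul_one] at h1
  exact lt_irrefl _ h1

/-- The transition matrix of two independent chains. -/
def pairMatrix {S : Type*} (P P' : Matrix S S ℝ) : Matrix (S × S) (S × S) ℝ :=
  fun a b => P a.1 b.1 * P' a.2 b.2

lemma IsStochastic.pairMatrix {P P' : Matrix S S ℝ} (h : IsStochastic P) (h' : IsStochastic P') :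
    IsStochastic (pairMatrix P P') where
  nonneg a b := mul_nonneg (h.nonneg _ _) (h'.nonneg _ _)
  row_sum a := by
    rw [Fintype.sum_prod_type]
    simp only [AnonMarkov.pairMatrix, ← Finset.mul_sum, h.row_sum, h'.row_sum, mul_one]

/-- One factor is exchanged at a time, which is why only `P` and `R'` have to be stochastic. -/
lemma abs_pairMatrix_sub_le {P P' R R' : Matrix S S ℝ} {ε : ℝ} (hP : IsStochastic P)
    (hR' : IsStochastic R') (h : ∀ a b, |P a b - R a b| ≤ ε) (h' : ∀ a b, |P' a b - R' a b| ≤ ε)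
    (a b : S × S) : |pairMatrix P P' a b - pairMatrix R R' a b| ≤ 2 * ε := by
  have : pairMatrix P P' a b - pairMatrix R R' a b
      = P a.1 b.1 * (P' a.2 b.2 - R' a.2 b.2) + (P a.1 b.1 - R a.1 b.1) * R' a.2 b.2 := by
    simp only [pairMatrix]; ring
  rw [this]
  have h1 : |P a.1 b.1 * (P' a.2 b.2 - R' a.2 b.2)| ≤ ε := by
    rw [abs_mul, abs_of_nonneg (hP.nonneg _ _)]
    exact (mul_le_of_le_one_left (abs_nonneg _) (hP.le_one _ _)).trans (h' _ _)
  have h2 : |(P a.1 b.1 - R a.1 b.1) * R' a.2 b.2| ≤ ε := by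
    rw [abs_mul, abs_of_nonneg (hR'.nonneg _ _)]
    exact (mul_le_of_le_one_right (abs_nonneg _) (hR'.le_one _ _)).trans (h _ _)
  exact (abs_add_le _ _).trans (by linarith)

variable [DecidableEq S]

lemma pow_row_sum {Q : Matrix S S ℝ} (hrow : ∀ a, ∑ b, Q a b = 1) (N : ℕ) (a : S) :
    ∑ b, (Q ^ N) a b = 1 := by
  induction N generalizing a with
  | zero => simp [Matrix.one_apply]
  | succ N ih =>
    simp_rw [pow_succ, Matrix.mul_apply]
    rw [Finset.sum_comm]
    simp_rw [← Finset.mul_sum, hrow, mul_one]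
    exact ih a

/-- For a primitive transition matrix, a vector with sum zero is controlled by its defect of
invariance. -/
lemma exists_abs_le_of_vecMul_sub {Q : Matrix S S ℝ} (hrow : ∀ a, ∑ b, Q a b = 1) {N : ℕ}
    (hpos : ∀ a b, 0 < (Q ^ N) a b) :
    ∃ K : ℝ, 0 < K ∧ ∀ (ν : S → ℝ) (e : ℝ), ∑ a, ν a = 0 →
      (∀ b, |ν b - ∑ a, ν a * Q a b| ≤ e) → ∀ b, |ν b| ≤ K * e := by
  -- The second component removes the stationary vector from the kernel. So `T` is injective, and in
  -- finite dimension an injective linear map is bounded below.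
  let T : (S → ℝ) →ₗ[ℝ] (S → ℝ) × ℝ :=
    LinearMap.prod (LinearMap.id - Matrix.vecMulLinear Q) (∑ a, LinearMap.proj a)
  have hT : ∀ ν, T ν = (ν - Matrix.vecMul ν Q, ∑ a, ν a) := by
    intro ν; simp [T]
  have hker : T.ker = ⊥ := by
    rw [LinearMap.ker_eq_bot']
    intro ν hν
    rw [hT, Prod.mk_eq_zero, sub_eq_zero] at hν
    refine eq_zero_of_vecMul_eq_self (pow_row_sum hrow N) hpos ?_ hν.2
    have : ∀ k, Matrix.vecMul ν (Q ^ k) = ν := by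
      intro k
      induction k with
      | zero => simp
      | succ k ih => rw [pow_succ, ← Matrix.vecMul_vecMul, ih, ← hν.1]
    exact this N
  obtain ⟨K, hK, hanti⟩ := T.exists_antilipschitzWith hker
  refine ⟨K, by exact_mod_cast hK, fun ν e hsum he b => ?_⟩
  have he0 : 0 ≤ e := (abs_nonneg _).trans (he b)
  have h1 : ‖ν‖ ≤ K * ‖T ν‖ := by
    simpa using hanti.le_mul_dist ν 0
  have h2 : ‖T ν‖ ≤ e := by
    rw [hT, hsum, Prod.norm_mk, norm_zero]
    refine max_le ((pi_norm_le_iff_of_nonneg he0).2 fun b => ?_) he0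
    exact he b
  calc |ν b| ≤ ‖ν‖ := norm_le_pi_norm ν b
    _ ≤ K * ‖T ν‖ := h1
    _ ≤ K * e := by gcongr

/-- This reduces primitivity of the product matrix to positivity of the same power of both factors.
-/
lemma pairMatrix_pow (P P' : Matrix S S ℝ) (N : ℕ) :
    pairMatrix P P' ^ N = pairMatrix (P ^ N) (P' ^ N) := by
  induction N with
  | zero =>
    ext a b
    simp only [pow_zero, Matrix.one_apply, pairMatrix, Prod.ext_iff]
    split_ifs <;> simp_all
  | succ N ih =>
    ext a b
    rw [pow_succ, ih, Matrix.mul_apply, Fintype.sum_prod_type]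
    simp only [pairMatrix, pow_succ, Matrix.mul_apply, Finset.sum_mul_sum]
    refine Finset.sum_congr rfl fun _ _ => Finset.sum_congr rfl fun _ _ => by ring

lemma sum_occ_pair_snd (M : ℕ) (y y' : ℕ → S) (a : S) :
    ∑ b, occ M (fun t => (y t, y' t)) (a, b) = occ M y a := by
  unfold occ
  rw [Finset.sum_comm]
  refine Finset.sum_congr rfl fun t _ => ?_
  by_cases h : y t = a <;> simp [h]

lemma sum_occ_pair_fst (M : ℕ) (y y' : ℕ → S) (b : S) :
    ∑ a, occ M (fun t => (y t, y' t)) (a, b) = occ M y' b := by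
  unfold occ
  rw [Finset.sum_comm]
  refine Finset.sum_congr rfl fun t _ => ?_
  by_cases h : y' t = b <;> simp [h]

lemma occ_le (M : ℕ) (y : ℕ → S) (a : S) : occ M y a ≤ M := by
  rw [← sum_occ M y]
  exact Finset.single_le_sum (fun a _ => occ_nonneg M y a) (Finset.mem_univ a)

/-- If the joint occupation of two sequences is almost invariant under the transition matrix of
independent chains, it is close to the product of the occupations. -/
lemma abs_occ_pair_sub_le {P P' : Matrix S S ℝ} (hP : IsStochastic P) (hP' : IsStochastic P')
    {K : ℝ}
    (hK : ∀ (ν : S × S → ℝ) (e : ℝ), ∑ a, ν a = 0 →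
      (∀ b, |ν b - ∑ a, ν a * pairMatrix P P' a b| ≤ e) → ∀ b, |ν b| ≤ K * e)
    {M : ℕ} (hM : 0 < M) (y y' : ℕ → S) {e : ℝ}
    (he : ∀ z, |occ M (fun t => (y t, y' t)) z
      - ∑ x, occ M (fun t => (y t, y' t)) x * pairMatrix P P' x z| ≤ e) (a b : S) :
    |occ M (fun t => (y t, y' t)) (a, b) - occ M y a * occ M y' b / M|
      ≤ K * ((1 + 2 * Fintype.card S) * e) := by
  have hM' : (0 : ℝ) < M := by exact_mod_cast hM
  set ν := occ M (fun t => (y t, y' t)) with hν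
  have hν1 : ∀ a, ∑ b, ν (a, b) = occ M y a := sum_occ_pair_snd M y y'
  have hν2 : ∀ b, ∑ a, ν (a, b) = occ M y' b := sum_occ_pair_fst M y y'
  -- Summing the joint defect over one coordinate gives the defect of a marginal, because the other
  -- matrix has row sums one.
  have h1 : ∀ a', |occ M y a' - ∑ a, occ M y a * P a a'| ≤ Fintype.card S * e := by
    intro a'
    have : occ M y a' - ∑ a, occ M y a * P a a'
        = ∑ b', (ν (a', b') - ∑ x, ν x * pairMatrix P P' x (a', b')) := by
      rw [Finset.sum_sub_distrib, hν1, Finset.sum_comm]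
      congr 1
      simp_rw [← Finset.mul_sum, pairMatrix, ← Finset.mul_sum, hP'.row_sum, mul_one]
      rw [Fintype.sum_prod_type]
      simp_rw [← Finset.sum_mul, hν1]
    rw [this]
    refine (Finset.abs_sum_le_sum_abs _ _).trans ((Finset.sum_le_card_nsmul _ _ e
      fun b' _ => he _).trans (by simp))
  have h2 : ∀ b', |occ M y' b' - ∑ b, occ M y' b * P' b b'| ≤ Fintype.card S * e := by
    intro b'
    have : occ M y' b' - ∑ b, occ M y' b * P' b b'
        = ∑ a', (ν (a', b') - ∑ x, ν x * pairMatrix P P' x (a', b')) := by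
      rw [Finset.sum_sub_distrib, hν2, Finset.sum_comm]
      congr 1
      simp_rw [← Finset.mul_sum, pairMatrix, ← Finset.sum_mul, hP.row_sum, one_mul]
      rw [Fintype.sum_prod_type_right]
      simp_rw [← Finset.sum_mul, hν2]
    rw [this]
    refine (Finset.abs_sum_le_sum_abs _ _).trans ((Finset.sum_le_card_nsmul _ _ e
      fun b' _ => he _).trans (by simp))
  -- `κ` has sum zero, so `hK` applies. Its defect is the joint one minus that of the product of
  -- marginals, and the latter telescopes into the two marginal defects.
  set κ : S × S → ℝ := fun z => ν z - occ M y z.1 * occ M y' z.2 / M with hκ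
  refine hK κ _ ?_ ?_ (a, b)
  · rw [hκ, Finset.sum_sub_distrib, hν, sum_occ, Fintype.sum_prod_type]
    simp only
    simp_rw [← Finset.sum_div, ← Finset.mul_sum, sum_occ]
    rw [← Finset.sum_mul, sum_occ]
    field_simp
    ring
  · rintro ⟨a', b'⟩
    set A := ∑ a, occ M y a * P a a' with hA
    set B := ∑ b, occ M y' b * P' b b' with hB
    have hsum : ∑ z : S × S, κ z * pairMatrix P P' z (a', b')
        = ∑ z, ν z * pairMatrix P P' z (a', b') - A * B / M := by
      simp_rw [hκ, sub_mul]
      rw [Finset.sum_sub_distrib]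
      congr 1
      rw [hA, hB, Finset.sum_mul_sum, Fintype.sum_prod_type, Finset.sum_div]
      refine Finset.sum_congr rfl fun _ _ => ?_
      rw [Finset.sum_div]
      refine Finset.sum_congr rfl fun _ _ => ?_
      simp only [pairMatrix]
      ring
    have hdec : κ (a', b') - ∑ z, κ z * pairMatrix P P' z (a', b')
        = (ν (a', b') - ∑ z, ν z * pairMatrix P P' z (a', b'))
          - ((occ M y a' - A) * (occ M y' b' / M) + (A / M) * (occ M y' b' - B)) := by
      rw [hsum, hκ]
      field_simp
      ring
    have hA0 : 0 ≤ A := Finset.sum_nonneg fun a _ => mul_nonneg (occ_nonneg _ _ _) (hP.nonneg _ _)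
    have hA1 : A ≤ M := by
      rw [← sum_occ M y]
      exact Finset.sum_le_sum fun a _ =>
        mul_le_of_le_one_right (occ_nonneg _ _ _) (hP.le_one _ _)
    have hq1 : |occ M y' b' / M| ≤ 1 := by
      rw [abs_of_nonneg (div_nonneg (occ_nonneg _ _ _) hM'.le)]
      exact div_le_one_of_le₀ (occ_le _ _ _) hM'.le
    have hq2 : |A / M| ≤ 1 := by
      rw [abs_of_nonneg (div_nonneg hA0 hM'.le)]
      exact div_le_one_of_le₀ hA1 hM'.le
    rw [hdec]
    have t1 : |(occ M y a' - A) * (occ M y' b' / M)| ≤ Fintype.card S * e := by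
      rw [abs_mul]
      exact (mul_le_of_le_one_right (abs_nonneg _) hq1).trans (h1 a')
    have t2 : |(A / M) * (occ M y' b' - B)| ≤ Fintype.card S * e := by
      rw [abs_mul]
      exact (mul_le_of_le_one_left (abs_nonneg _) hq2).trans (h2 b')
    have t3 := he (a', b')
    have t4 := abs_sub (ν (a', b') - ∑ z, ν z * pairMatrix P P' z (a', b'))
      ((occ M y a' - A) * (occ M y' b' / M) + (A / M) * (occ M y' b' - B))
    have t5 := abs_add_le ((occ M y a' - A) * (occ M y' b' / M)) ((A / M) * (occ M y' b' - B))
    linarith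

/-- A sequence whose transition counts fit a matrix close to `Q` has an occupation that is almost
invariant under `Q`. -/
lemma abs_occ_sub_sum_le {Q Q' : Matrix S S ℝ} {M : ℕ} {z : ℕ → S} {l ε : ℝ}
    (hl : ∀ a b, |trans M z a b - occ M z a * Q' a b| ≤ l) (hQ : ∀ a b, |Q' a b - Q a b| ≤ ε)
    (b : S) :
    |occ M z b - ∑ a, occ M z a * Q a b| ≤ 1 + Fintype.card S * l + M * ε := by
  have h0 := sum_trans_left M z b
  have h1 : occ M z b - ∑ a, occ M z a * Q a b
      = ((if z 0 = b then 1 else 0) - (if z M = b then 1 else 0))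
        + ∑ a, (trans M z a b - occ M z a * Q' a b) + ∑ a, occ M z a * (Q' a b - Q a b) := by
    simp_rw [mul_sub, Finset.sum_sub_distrib]
    linarith
  have h2 : |∑ a, (trans M z a b - occ M z a * Q' a b)| ≤ Fintype.card S * l :=
    (Finset.abs_sum_le_sum_abs _ _).trans ((Finset.sum_le_card_nsmul _ _ l
      fun a _ => hl a b).trans (by simp))
  have h3 : |∑ a, occ M z a * (Q' a b - Q a b)| ≤ M * ε := by
    refine (Finset.abs_sum_le_sum_abs _ _).trans ?_
    rw [← sum_occ M z, Finset.sum_mul]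
    refine Finset.sum_le_sum fun a _ => ?_
    rw [abs_mul, abs_of_nonneg (occ_nonneg _ _ _)]
    exact mul_le_mul_of_nonneg_left (hQ a b) (occ_nonneg _ _ _)
  have h4 : |((if z 0 = b then 1 else 0) - (if z M = b then 1 else 0) : ℝ)| ≤ 1 := by
    split_ifs <;> simp
  rw [h1]
  exact (abs_add_three _ _ _).trans (by linarith)

end Stationary

/-! ### Convergence of empirical frequencies -/

section MeanErgodic

variable {α : Type*} [MeasurableSpace α] {μ : Measure α} [IsProbabilityMeasure μ] {T : α → α}

/-- The mean ergodic theorem for the indicator of a set: the visit frequencies converge in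
measure. -/
theorem tendstoInMeasure_visit_frequency (hT : Ergodic T μ) {A : Set α} (hA : MeasurableSet A) :
    TendstoInMeasure μ (fun (n : ℕ) x => (n : ℝ)⁻¹ * ∑ t ∈ Finset.range n,
      A.indicator (fun _ => (1 : ℝ)) (T^[t] x)) atTop (fun _ => μ.real A) := by
  have hmp : MeasurePreserving T μ μ := hT.toMeasurePreserving
  -- The Koopman operator. By von Neumann's theorem, its averages converge in `L²` to the projection
  -- `g` on the fixed space.
  let U : Lp ℝ 2 μ →L[ℝ] Lp ℝ 2 μ := (Lp.compMeasurePreservingₗᵢ ℝ T hmp).toContinuousLinearMap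
  have hUcoe : ∀ g : Lp ℝ 2 μ, U g =ᵐ[μ] g ∘ T := fun g => Lp.coeFn_compMeasurePreserving g hmp
  set f : Lp ℝ 2 μ := indicatorConstLp 2 hA (measure_ne_top μ A) 1 with hf
  set e : Lp ℝ 2 μ := indicatorConstLp 2 MeasurableSet.univ (measure_ne_top μ _) 1 with he
  have hlim := U.tendsto_birkhoffAverage_orthogonalProjection
    (LinearIsometry.norm_toContinuousLinearMap_le _) f
  set g : Lp ℝ 2 μ :=
    ((U.eqLocus (1 : Lp ℝ 2 μ →L[ℝ] Lp ℝ 2 μ)).orthogonalProjectionOnto f : Lp ℝ 2 μ) with hg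
  have hgU : U g = g :=
    ((U.eqLocus (1 : Lp ℝ 2 μ →L[ℝ] Lp ℝ 2 μ)).orthogonalProjectionOnto f).2
  have heU : U e = e := by
    have := Lp.indicatorConstLp_compMeasurePreserving (p := 2) (E := ℝ) MeasurableSet.univ
      (measure_ne_top μ _) 1 hmp
    exact this
  -- Ergodicity makes the invariant limit constant; pairing with the invariant function `e = 1`
  -- identifies the constant.
  obtain ⟨c, hc⟩ := hT.ae_eq_const_of_ae_eq_comp_ae (g := g) (Lp.aestronglyMeasurable g)
    ((hUcoe g).symm.trans (by rw [hgU]))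
  have hint : inner ℝ e f = inner ℝ e g := by
    have h1 := Submodule.starProjection_inner_eq_zero
      (K := U.eqLocus (1 : Lp ℝ 2 μ →L[ℝ] Lp ℝ 2 μ)) f e heU
    rw [Submodule.starProjection_apply, ← hg, real_inner_comm, inner_sub_right, sub_eq_zero] at h1
    exact h1
  have hcA : c = μ.real A := by
    rw [he, L2.inner_indicatorConstLp_one, L2.inner_indicatorConstLp_one, setIntegral_univ,
      setIntegral_univ, integral_congr_ae hc, hf, integral_indicatorConstLp] at hint
    simpa using hint.symm
  have hiter : ∀ t, (U^[t] f : Lp ℝ 2 μ) =ᵐ[μ] fun x => A.indicator (fun _ => (1 : ℝ)) (T^[t] x) := by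
    intro t
    induction t with
    | zero => exact indicatorConstLp_coeFn (hs := hA) (hμs := measure_ne_top μ A)
    | succ t ih =>
      rw [Function.iterate_succ_apply']
      refine (hUcoe _).trans ((hmp.quasiMeasurePreserving.ae_eq_comp ih).trans ?_)
      filter_upwards with x
      simp [Function.iterate_succ_apply]
  have hsum : ∀ n : ℕ, (birkhoffAverage ℝ U _root_.id n f : Lp ℝ 2 μ) =ᵐ[μ]
      fun x => (n : ℝ)⁻¹ * ∑ t ∈ Finset.range n, A.indicator (fun _ => (1 : ℝ)) (T^[t] x) := by
    intro n
    have h1 : (birkhoffSum U _root_.id n f : Lp ℝ 2 μ) =ᵐ[μ]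
        fun x => ∑ t ∈ Finset.range n, A.indicator (fun _ => (1 : ℝ)) (T^[t] x) := by
      induction n with
      | zero =>
        filter_upwards with x
        simp
      | succ n ih =>
        rw [birkhoffSum_succ]
        filter_upwards [Lp.coeFn_add (birkhoffSum U _root_.id n f) (id (U^[n] f)), ih, hiter n]
          with x h1 h2 h3
        rw [h1, Finset.sum_range_succ, Pi.add_apply, h2, id, h3]
    filter_upwards [Lp.coeFn_smul (n : ℝ)⁻¹ (birkhoffSum U _root_.id n f), h1] with x h2 h3
    rw [birkhoffAverage, h2, Pi.smul_apply, h3, smul_eq_mul]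
  refine (tendstoInMeasure_of_tendsto_Lp hlim).congr hsum ?_
  rw [← hcA]
  exact hc

end MeanErgodic

/-! ### Frequencies along a process with ergodic law. -/

section Frequencies

variable {Ω V : Type*} [MeasurableSpace Ω] [MeasurableSpace V] {μ : Measure Ω}

lemma iterate_shift {V : Type*} (t : ℕ) (y : ℕ → V) : shift^[t] y = fun k => y (k + t) := by
  induction t generalizing y with
  | zero => rfl
  | succ t ih =>
    rw [Function.iterate_succ_apply, ih]
    funext k
    simp only [shift]
    congr 1

lemma measureReal_eq_of_ergodic {Y : Ω → ℕ → V} (hY : Measurable Y)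
    (herg : Ergodic shift (μ.map Y)) {B : Set V} (hB : MeasurableSet B) (t : ℕ) :
    μ.real {ω | Y ω t ∈ B} = μ.real {ω | Y ω 0 ∈ B} := by
  have hA : MeasurableSet {y : ℕ → V | y 0 ∈ B} := measurable_pi_apply 0 hB
  have hmp := herg.toMeasurePreserving.iterate t
  have h1 := hmp.measureReal_preimage hA.nullMeasurableSet
  rw [map_measureReal_apply hY hA, map_measureReal_apply hY (hmp.measurable hA)] at h1
  simpa only [Set.preimage_ofPred_eq, iterate_shift, zero_add] using h1

variable [IsProbabilityMeasure μ]

lemma tendsto_measure_frequency {Y : Ω → ℕ → V} (hY : Measurable Y)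
    (herg : Ergodic shift (μ.map Y)) {B : Set V} (hB : MeasurableSet B) {ε : ℝ} (hε : 0 < ε) :
    Tendsto (fun M : ℕ => μ {ω | ε ≤ |(M : ℝ)⁻¹ * ∑ t ∈ Finset.range M,
      B.indicator (fun _ => (1 : ℝ)) (Y ω t) - μ.real {ω | Y ω 0 ∈ B}|}) atTop (𝓝 0) := by
  have : IsProbabilityMeasure (μ.map Y) := Measure.isProbabilityMeasure_map hY.aemeasurable
  have hA : MeasurableSet {y : ℕ → V | y 0 ∈ B} := measurable_pi_apply 0 hB
  have h1 := tendstoInMeasure_iff_norm.1 (tendstoInMeasure_visit_frequency herg hA) ε hε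
  refine h1.congr fun M => ?_
  have hshift : Measurable (shift : (ℕ → V) → ℕ → V) := herg.measurable
  rw [Measure.map_apply hY, map_measureReal_apply hY hA]
  · congr 1
    ext ω
    have h2 : ∀ t, {y : ℕ → V | y 0 ∈ B}.indicator (fun _ => (1 : ℝ)) (fun k => Y ω (k + t))
        = B.indicator (fun _ => (1 : ℝ)) (Y ω t) := by
      intro t
      by_cases h : Y ω t ∈ B
      · rw [Set.indicator_of_mem h, Set.indicator_of_mem (by simpa using h)]
      · rw [Set.indicator_of_notMem h, Set.indicator_of_notMem (by simpa using h)]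
    simp only [Set.mem_ofPred_eq, Real.norm_eq_abs, iterate_shift, h2,
      Set.preimage_ofPred_eq]
  · refine measurableSet_le measurable_const (Measurable.norm (Measurable.sub ?_ measurable_const))
    refine Measurable.const_mul (Finset.measurable_sum _ fun t _ => ?_) _
    exact (measurable_const.indicator hA).comp (hshift.iterate t)

end Frequencies

/-! ### The law of the parameter vectors -/

section ParamLaw

variable {r : ℕ} {E : Finset (Fin r × Fin r)} {base : Fin r → Fin r}

instance (f : ParamDensity E base) : IsProbabilityMeasure f.allLaw := by
  unfold ParamDensity.allLaw
  infer_instance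

lemma ParamDensity.ae_mem_paramRange (f : ParamDensity E base) :
    ∀ᵐ p ∂f.allLaw, ∀ u, p u ∈ paramRange E base := by
  rw [ae_all_iff]
  intro u
  have h : ∀ᵐ x ∂f.law, x ∈ paramRange E base := by
    unfold ParamDensity.law
    rw [ae_withDensity_iff f.measurable_density.ennreal_ofReal]
    filter_upwards with x hx
    by_contra h
    exact hx (by simp [f.density_eq_zero x h])
  exact (measurePreserving_eval_infinitePi (fun _ : ℕ => f.law) u).quasiMeasurePreserving.ae h

/-- The density is at most `max δ 0` everywhere, as it vanishes off the range, and a ball of the sup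
norm is a cube of volume `(2 * ε) ^ d`. -/
lemma ParamDensity.exists_law_closedBall_le (f : ParamDensity E base) :
    ∃ D : ℝ, 0 ≤ D ∧ ∀ x ε, 0 ≤ ε → f.law (Metric.closedBall x ε) ≤
      ENNReal.ofReal (D * ε ^ Fintype.card (FreeEdge E base)) := by
  obtain ⟨δ, hδ⟩ := f.density_bounded
  set d := Fintype.card (FreeEdge E base) with hd
  refine ⟨max δ 0 * 2 ^ d, by positivity, fun x ε hε => ?_⟩
  have hle : ∀ y, f.density y ≤ max δ 0 := by
    intro y
    by_cases hy : y ∈ paramRange E base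
    · exact (hδ y hy).trans (le_max_left _ _)
    · rw [f.density_eq_zero y hy]; exact le_max_right _ _
  unfold ParamDensity.law
  rw [withDensity_apply _ measurableSet_closedBall]
  calc _ ≤ ∫⁻ _ in Metric.closedBall x ε, ENNReal.ofReal (max δ 0) :=
        lintegral_mono fun y => ENNReal.ofReal_le_ofReal (hle y)
    _ = ENNReal.ofReal (max δ 0) * ENNReal.ofReal ((2 * ε) ^ d) := by
        rw [setLIntegral_const, Real.volume_pi_closedBall x hε]
    _ = _ := by
        rw [← ENNReal.ofReal_mul (le_max_right _ _), mul_pow]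
        congr 1; ring

/-- The probability that several pairs of users, all different, have close parameters. -/
lemma ParamDensity.allLaw_dist_le (f : ParamDensity E base) {B : ℝ≥0∞} {ε : ℝ}
    (hB : ∀ x, f.law (Metric.closedBall x ε) ≤ B) {ι : Type*} [Fintype ι] (a b : ι → ℕ)
    (hab : Function.Injective (Sum.elim a b)) :
    f.allLaw {p | ∀ i, dist (p (b i)) (p (a i)) ≤ ε} ≤ B ^ Fintype.card ι := by
  have hind : iIndepFun (fun (u : ℕ) (p : ℕ → Param E base) => p u) f.allLaw :=
    iIndepFun_infinitePi (P := fun _ : ℕ => f.law) (X := fun _ x => x) fun _ => measurable_id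
  have hmap := (iIndepFun_iff_map_fun_eq_pi_map
    (fun j => (measurable_pi_apply (Sum.elim a b j)).aemeasurable)).1 (hind.precomp hab)
  have heval : ∀ u, f.allLaw.map (fun p => p u) = f.law := fun u =>
    (measurePreserving_eval_infinitePi (fun _ : ℕ => f.law) u).map_eq
  simp_rw [heval] at hmap
  have hmp : MeasurePreserving (fun (p : ℕ → Param E base) (j : ι ⊕ ι) => p (Sum.elim a b j))
      f.allLaw (Measure.pi fun _ : ι ⊕ ι => f.law) :=
    ⟨measurable_pi_lambda _ fun j => measurable_pi_apply _, hmap⟩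
  have hmp2 := (measurePreserving_sumPiEquivProdPi
    (fun _ : ι ⊕ ι => f.law)).comp hmp
  set A : Set ((ι → Param E base) × (ι → Param E base)) := {q | ∀ i, dist (q.2 i) (q.1 i) ≤ ε}
    with hA
  have hAm : MeasurableSet A := by
    rw [hA, Set.ofPred_forall]
    exact MeasurableSet.iInter fun i => measurableSet_le
      (((measurable_pi_apply i).comp measurable_snd).dist
        ((measurable_pi_apply i).comp measurable_fst)) measurable_const
  have h1 := hmp2.measure_preimage hAm.nullMeasurableSet
  have h2 : (⇑(MeasurableEquiv.sumPiEquivProdPi fun _ : ι ⊕ ι => Param E base) ∘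
      fun (p : ℕ → Param E base) (j : ι ⊕ ι) => p (Sum.elim a b j)) ⁻¹' A
      = {p | ∀ i, dist (p (b i)) (p (a i)) ≤ ε} := by
    ext p
    rfl
  rw [← h2, h1, Measure.prod_apply hAm]
  -- Given the vectors at `a`, those at `b` must fall independently into balls, and the bound `B`
  -- does not depend on the centres.
  calc _ ≤ ∫⁻ _, B ^ Fintype.card ι ∂(Measure.pi fun _ : ι => f.law) := by
        refine lintegral_mono fun x => ?_
        have : Prod.mk x ⁻¹' A = Set.univ.pi fun i => Metric.closedBall (x i) ε := by
          ext y; simp [hA]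
        rw [this, Measure.pi_pi]
        exact (Finset.prod_le_prod' fun i _ => hB (x i)).trans (by simp)
    _ = B ^ Fintype.card ι := by simp

end ParamLaw

/-! ### The tests of the adversary -/

section Tests

variable {r : ℕ}

/-- The transition counts of `y` fit the transition matrix `P`, up to the error `lam`, and each
state is visited at least `eta` times. -/
def RowTest (M : ℕ) (lam eta : ℝ) (P : Matrix (Fin r) (Fin r) ℝ) (y : ℕ → Fin r) : Prop :=
  ∀ i j, |trans M y i j - occ M y i * P i j| ≤ lam ∧ eta ≤ occ M y i

/-- The empirical joint distribution of `y` and `y'` is not close to a product. -/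
def DepTest (M : ℕ) (theta : ℝ) (y y' : ℕ → Fin r) : Prop :=
  ∃ a b, theta * M < |occ M (fun t => (y t, y' t)) (a, b) - occ M y a * occ M y' b / M|

lemma RowTest.congr {M : ℕ} {lam eta : ℝ} {P : Matrix (Fin r) (Fin r) ℝ} {y z : ℕ → Fin r}
    (hyz : ∀ t < M + 1, y t = z t) (h : RowTest M lam eta P y) : RowTest M lam eta P z := by
  intro i j
  have := h i j
  rwa [trans_congr hyz, occ_congr fun t ht => hyz t (by omega)] at this

lemma DepTest.congr {M : ℕ} {theta : ℝ} {y y' z z' : ℕ → Fin r}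
    (hyz : ∀ t < M + 1, y t = z t) (hyz' : ∀ t < M + 1, y' t = z' t)
    (h : DepTest M theta y y') : DepTest M theta z z' := by
  obtain ⟨a, b, hab⟩ := h
  refine ⟨a, b, ?_⟩
  rwa [occ_congr (z := z) fun t ht => hyz t (by omega),
    occ_congr (z := z') fun t ht => hyz' t (by omega),
    occ_congr (z := fun t => (z t, z' t)) fun t ht => by
      rw [hyz t (by omega), hyz' t (by omega)]] at hab

/-- Parameters of a chain that passes the test of another one, when its own transition counts are
not exceptional. -/
lemma RowTest.abs_sub_le {M : ℕ} {lam eta : ℝ} (heta : 0 < eta) {P P' : Matrix (Fin r) (Fin r) ℝ}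
    {y : ℕ → Fin r} (h : RowTest M lam eta P y)
    (h' : ∀ i j, |trans M y i j - occ M y i * P' i j| ≤ lam) (i j : Fin r) :
    |P' i j - P i j| ≤ 2 * lam / eta := by
  obtain ⟨h1, h2⟩ := h i j
  have h3 := h' i j
  have h4 : |occ M y i * (P' i j - P i j)| ≤ 2 * lam := by
    have : occ M y i * (P' i j - P i j) = (trans M y i j - occ M y i * P i j)
      - (trans M y i j - occ M y i * P' i j) := by ring
    rw [this]
    exact (abs_sub _ _).trans (by linarith)
  rw [abs_mul, abs_of_nonneg (occ_nonneg _ _ _)] at h4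
  rw [le_div_iff₀ heta, mul_comm]
  exact (mul_le_mul_of_nonneg_right h2 (abs_nonneg _)).trans h4

/-- Sequences that behave like independent chains do not pass the test of dependence. -/
lemma not_depTest {M : ℕ} (hM : 0 < M) {lam ε theta K : ℝ}
    {P P' R R' : Matrix (Fin r) (Fin r) ℝ} (hP : IsStochastic P) (hP' : IsStochastic P')
    (hR : IsStochastic R) {y y' : ℕ → Fin r}
    (hK : ∀ (ν : Fin r × Fin r → ℝ) (e : ℝ), ∑ a, ν a = 0 →
      (∀ b, |ν b - ∑ a, ν a * pairMatrix P P' a b| ≤ e) → ∀ b, |ν b| ≤ K * e)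
    (hRP : ∀ i j, |R i j - P i j| ≤ ε) (hRP' : ∀ i j, |R' i j - P' i j| ≤ ε)
    (hpair : ∀ a b, |trans M (fun t => (y t, y' t)) a b
      - occ M (fun t => (y t, y' t)) a * pairMatrix R R' a b| ≤ lam)
    (hsmall : K * ((1 + 2 * r) * (1 + r * r * lam + M * (2 * ε))) ≤ theta * M) :
    ¬ DepTest M theta y y' := by
  rintro ⟨a, b, hab⟩
  have h1 := abs_occ_sub_sum_le hpair (abs_pairMatrix_sub_le hR hP' hRP hRP')
  have h2 := abs_occ_pair_sub_le hP hP' hK hM y y' h1 a b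
  simp only [Fintype.card_prod, Fintype.card_fin, Nat.cast_mul] at h2
  linarith

lemma measurable_occ {Ω S : Type*} [MeasurableSpace Ω] [MeasurableSpace S]
    [MeasurableSingletonClass S] [DecidableEq S] {X : ℕ → Ω → S} (hX : ∀ t, Measurable (X t))
    (M : ℕ) (a : S) : Measurable fun ω => occ M (fun t => X t ω) a :=
  Finset.measurable_sum _ fun t _ =>
    Measurable.ite (hX t (measurableSet_singleton a)) measurable_const measurable_const

lemma measurable_trans {Ω S : Type*} [MeasurableSpace Ω] [MeasurableSpace S]
    [MeasurableSingletonClass S] [DecidableEq S] {X : ℕ → Ω → S} (hX : ∀ t, Measurable (X t))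
    (M : ℕ) (a b : S) : Measurable fun ω => trans M (fun t => X t ω) a b :=
  Finset.measurable_sum _ fun t _ =>
    Measurable.ite ((hX t (measurableSet_singleton a)).inter
      (hX (t + 1) (measurableSet_singleton b))) measurable_const measurable_const

lemma measurable_rowTest {Ω : Type*} [MeasurableSpace Ω] {X : ℕ → Ω → Fin r}
    (hX : ∀ t, Measurable (X t)) {P : Ω → Matrix (Fin r) (Fin r) ℝ}
    (hP : ∀ i j, Measurable fun ω => P ω i j) (M : ℕ) (lam eta : ℝ) :
    Measurable fun ω => RowTest M lam eta (P ω) fun t => X t ω := by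
  refine Measurable.forall fun i => Measurable.forall fun j => Measurable.and ?_ ?_
  · refine measurableSet_setOfPred.1 (measurableSet_le ?_ measurable_const)
    exact measurable_abs.comp ((measurable_trans hX M i j).sub
      ((measurable_occ hX M i).mul (hP i j)))
  · exact measurableSet_setOfPred.1 (measurableSet_le measurable_const (measurable_occ hX M i))

lemma measurable_depTest {Ω : Type*} [MeasurableSpace Ω] {X X' : ℕ → Ω → Fin r}
    (hX : ∀ t, Measurable (X t)) (hX' : ∀ t, Measurable (X' t)) (M : ℕ) (theta : ℝ) :
    Measurable fun ω => DepTest M theta (fun t => X t ω) fun t => X' t ω := by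
  refine Measurable.exists fun a => Measurable.exists fun b => ?_
  refine measurableSet_setOfPred.1 (measurableSet_lt measurable_const (measurable_abs.comp ?_))
  exact (measurable_occ (fun t => (hX t).prodMk (hX' t)) M (a, b)).sub
    (((measurable_occ hX M a).mul (measurable_occ hX' M b)).div_const _)

variable {E : Finset (Fin r × Fin r)} {base : Fin r → Fin r} {G : SimpleGraph ℕ}

/-- The sequences `y u` pass all tests for the members `u` of the group `C`, whose parameter
vectors are `p u`. -/
def Passes (C : G.ConnectedComponent) (M : ℕ) (lam eta theta : ℝ) (p : C.supp → Param E base)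
    (y : C.supp → ℕ → Fin r) : Prop :=
  (∀ u, RowTest M lam eta (transMatrix E base (p u)) (y u)) ∧
    ∀ u v : C.supp, G.Adj u v → DepTest M theta (y u) (y v)

lemma Passes.congr {C : G.ConnectedComponent} {M : ℕ} {lam eta theta : ℝ}
    {p : C.supp → Param E base} {y z : C.supp → ℕ → Fin r}
    (hyz : ∀ u, ∀ t < M + 1, y u t = z u t) (h : Passes C M lam eta theta p y) :
    Passes C M lam eta theta p z :=
  ⟨fun u => (h.1 u).congr (hyz u), fun u v huv => (h.2 u v huv).congr (hyz u) (hyz v)⟩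

lemma measurable_passes {Ω : Type*} [MeasurableSpace Ω] (C : G.ConnectedComponent)
    {p : Ω → C.supp → Param E base} {X : C.supp → ℕ → Ω → Fin r}
    (hp : ∀ u, Measurable fun ω => p ω u) (hX : ∀ u t, Measurable (X u t))
    (M : ℕ) (lam eta theta : ℝ) :
    Measurable fun ω => Passes C M lam eta theta (p ω) fun u t => X u t ω := by
  refine Measurable.and (Measurable.forall fun u => ?_) (Measurable.forall fun u =>
    Measurable.forall fun v => Measurable.imp measurable_const ?_)
  · exact measurable_rowTest (hX u) (fun i j => (measurable_transMatrix i j).comp (hp u)) M lam eta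
  · exact measurable_depTest (hX u) (hX v) M theta

/-! ### The estimator -/

/-- The rows of a finite table, extended by the state `o`. -/
def extendRow {n m : ℕ} (o : Fin r) (Y : Fin n → Fin m → Fin r) (v : Fin n) (t : ℕ) : Fin r :=
  if h : t < m then Y v ⟨t, h⟩ else o

/-- A finite family of parameter vectors, extended by zero. -/
def extendParam {n : ℕ} (q : Fin n → Param E base) (u : ℕ) : Param E base :=
  if h : u < n then q ⟨u, h⟩ else 0

/-- The placements of the group `C` among the pseudonyms that pass all tests. -/
def passing (C : G.ConnectedComponent) {n m : ℕ} (o : Fin r) (lam eta theta : ℝ)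
    (q : (Fin n → Param E base) × (Fin n → Fin m → Fin r)) : Set (C.supp → Fin n) :=
  -- Among `m` samples there are only `m - 1` transitions; with this length the tests never read the
  -- padding by `o`.
  {v | Function.Injective v ∧ Passes C (m - 1) lam eta theta (fun u => extendParam q.1 u)
    fun u => extendRow o q.2 (v u)}

open Classical in
/-- The estimate of the sample at time `k` of the member `u` of the group `C`: the sample of the
pseudonym that `u` gets in some placement that passes all tests. -/
def groupEstimate (C : G.ConnectedComponent) (u : C.supp) {n m : ℕ} (o : Fin r)
    (lam eta theta : ℝ) (k : ℕ) (q : (Fin n → Param E base) × (Fin n → Fin m → Fin r)) : Fin r :=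
  if h : (passing C o lam eta theta q).Nonempty then extendRow o q.2 (h.some u) k else o

lemma measurable_extendParam {n : ℕ} (u : ℕ) :
    Measurable fun q : Fin n → Param E base => extendParam q u := by
  unfold extendParam
  split_ifs
  · exact measurable_pi_apply _
  · exact measurable_const

/-- For fixed observations, the estimate depends on the parameters only through the set of passing
placements. That set has finitely many possible values, so the arbitrary choice of an element is
harmless. -/
lemma measurable_groupEstimate (C : G.ConnectedComponent) [Finite C.supp] (u : C.supp) {n m : ℕ}
    (o : Fin r) (lam eta theta : ℝ) (k : ℕ) :
    Measurable (groupEstimate (E := E) (base := base) C u (n := n) (m := m) o lam eta theta k) := by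
  classical
  refine measurable_from_prod_countable_left fun Y => ?_
  have hset : Measurable fun q : Fin n → Param E base => passing C o lam eta theta (q, Y) := by
    refine measurable_set_iff.2 fun v => Measurable.and measurable_const ?_
    exact measurable_passes C (p := fun q u => extendParam q u)
      (X := fun u t _ => extendRow o Y (v u) t) (fun u => measurable_extendParam _)
      (fun u t => measurable_const) _ _ _ _
  have hout : Measurable fun T : Set (C.supp → Fin n) =>
      if h : T.Nonempty then extendRow o Y (h.some u) k else o :=
    Measurable.of_discrete
  exact hout.comp hset

/-- The event that the tests mislead the adversary who looks for the member `o` of `C`. -/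
def failure (E : Finset (Fin r × Fin r)) (base : Fin r → Fin r) (C : G.ConnectedComponent)
    (o : C.supp) (n M : ℕ) (lam eta theta : ℝ) : Set ((ℕ → Param E base) × Data r) :=
  {ω | ¬ Passes C M lam eta theta (fun u => ω.1 u) (fun u => ω.2 u) ∨
    ∃ w : C.supp → Fin n, Function.Injective w ∧ (w o : ℕ) ≠ o ∧
      Passes C M lam eta theta (fun u => ω.1 u) (fun u => ω.2 (w u))}

lemma measurable_data (u t : ℕ) :
    Measurable fun ω : (ℕ → Param E base) × Data r => ω.2 u t :=
  (measurable_pi_apply t).comp ((measurable_pi_apply u).comp measurable_snd)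

lemma measurable_passes_data (C : G.ConnectedComponent) (M : ℕ) (lam eta theta : ℝ)
    (w : C.supp → ℕ) :
    Measurable fun ω : (ℕ → Param E base) × Data r =>
      Passes C M lam eta theta (fun u => ω.1 u) (fun u => ω.2 (w u)) :=
  measurable_passes (Ω := (ℕ → Param E base) × Data r) C (p := fun ω u => ω.1 u)
    (X := fun u t ω => ω.2 (w u) t) (fun u => (measurable_pi_apply (u : ℕ)).comp measurable_fst)
    (fun u t => measurable_data (w u) t) M lam eta theta

lemma measurableSet_failure (C : G.ConnectedComponent) [Finite C.supp] (o : C.supp) (n M : ℕ)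
    (lam eta theta : ℝ) : MeasurableSet (failure E base C o n M lam eta theta) := by
  refine measurableSet_setOfPred.2 (Measurable.or (measurable_passes_data C M lam eta theta _).not ?_)
  exact Measurable.exists fun w => Measurable.and measurable_const
    (Measurable.and measurable_const
      (measurable_passes_data C M lam eta theta fun u => (w u : ℕ)))

/-- Undoing `π` turns placements among pseudonyms into placements among users. Off the failure event
the true placement passes, so one is found, and every passing one gives `u` its own trace. The
failure event does not involve `π`, so the law of the permutation will not matter. -/
lemma mem_failure_of_groupEstimate_ne {C : G.ConnectedComponent} {u : C.supp} {n m : ℕ}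
    {o : Fin r} {lam eta theta : ℝ} {k : ℕ} (hk : k < m) (hC : ∀ v : C.supp, (v : ℕ) < n)
    (π : Equiv.Perm (Fin n)) {ω : (ℕ → Param E base) × Data r}
    (hne : groupEstimate C u o lam eta theta k (fun v : Fin n => ω.1 v, anonymize m π ω.2)
      ≠ ω.2 u k) :
    ω ∈ failure E base C u n (m - 1) lam eta theta := by
  by_contra hnot
  simp only [failure, Set.mem_ofPred_eq, not_or, not_not, not_exists, not_and] at hnot
  obtain ⟨htrue, hfalse⟩ := hnot
  set q : (Fin n → Param E base) × (Fin n → Fin m → Fin r) :=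
    (fun v : Fin n => ω.1 v, anonymize m π ω.2) with hq
  have hparam : (fun v : C.supp => extendParam q.1 v) = fun v : C.supp => ω.1 v := by
    funext v
    simp [extendParam, hC v, hq]
  have hrow : ∀ (v : Fin n) (t : ℕ), t < m → extendRow o q.2 v t = ω.2 (π.symm v) t := by
    intro v t ht
    simp [extendRow, ht, hq, anonymize]
  have hnonempty : (passing C o lam eta theta q).Nonempty := by
    refine ⟨fun v => π ⟨v, hC v⟩, ?_, ?_⟩
    · intro v v' h
      have := π.injective h
      exact Subtype.ext (by simpa using this)
    · rw [hparam]
      refine htrue.congr fun v t ht => ?_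
      rw [hrow _ _ (by omega)]
      simp
  obtain ⟨hinj, hpass⟩ := hnonempty.some_mem
  have hw := hfalse (fun v => π.symm (hnonempty.some v)) (π.symm.injective.comp hinj)
  have hpass' : Passes C (m - 1) lam eta theta (fun v : C.supp => ω.1 v)
      fun v => ω.2 (π.symm (hnonempty.some v)) := by
    rw [hparam] at hpass
    exact hpass.congr fun v t ht => hrow _ _ (by omega)
  have heq : ((π.symm (hnonempty.some u) : Fin n) : ℕ) = u := by
    by_contra h
    exact hw h hpass'
  apply hne
  rw [groupEstimate, dif_pos hnonempty, hrow _ _ hk, heq]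

end Tests

/-! ### The tests for given parameters -/

section Conditional

variable {r : ℕ} {E : Finset (Fin r × Fin r)} {base : Fin r → Fin r} {G : SimpleGraph ℕ}

lemma measurable_sample (u t : ℕ) : Measurable fun x : Data r => x u t :=
  (measurable_pi_apply t).comp (measurable_pi_apply u)

/-- Two independent Markov chains form a Markov chain. -/
lemma IsMarkovChain.pair {Ω S : Type*} [MeasurableSpace Ω] [Countable S] [MeasurableSpace S]
    [MeasurableSingletonClass S] {μ : Measure Ω} {X X' : ℕ → Ω → S} {P P' : Matrix S S ℝ}
    (hX : IsMarkovChain μ X P) (hX' : IsMarkovChain μ X' P')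
    (hind : IndepFun (fun ω t => X t ω) (fun ω t => X' t ω) μ) :
    IsMarkovChain μ (fun t ω => (X t ω, X' t ω)) (pairMatrix P P') := by
  have key : ∀ (k : ℕ) (a : ℕ → S × S), μ.real {ω | ∀ j ≤ k, (X j ω, X' j ω) = a j}
      = μ.real {ω | ∀ j ≤ k, X j ω = (a j).1} * μ.real {ω | ∀ j ≤ k, X' j ω = (a j).2} := by
    intro k a
    have hm : ∀ b : ℕ → S, MeasurableSet {y : ℕ → S | ∀ j ≤ k, y j = b j} := fun b => by
      simp only [Set.ofPred_forall]
      exact MeasurableSet.iInter fun j => MeasurableSet.iInter fun _ =>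
        measurable_pi_apply j (measurableSet_singleton _)
    have h := hind.measure_inter_preimage_eq_mul _ _ (hm fun j => (a j).1) (hm fun j => (a j).2)
    simp only [measureReal_def, ← ENNReal.toReal_mul]
    simp only [Set.preimage_ofPred_eq] at h
    rw [← h]
    congr 2
    ext ω
    simp only [Set.mem_ofPred_eq, Set.mem_inter_iff, Prod.ext_iff]
    exact ⟨fun h => ⟨fun j hj => (h j hj).1, fun j hj => (h j hj).2⟩,
      fun h j hj => ⟨h.1 j hj, h.2 j hj⟩⟩
  intro k a
  rw [key, key, hX k fun j => (a j).1, hX' k fun j => (a j).2, pairMatrix]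
  ring

lemma tendsto_measure_iUnion_zero {Ω ι κ : Type*} [MeasurableSpace Ω] {μ : Measure Ω} [Finite ι]
    {A : ι → κ → Set Ω} {l : Filter κ} (h : ∀ i, Tendsto (fun M => μ (A i M)) l (𝓝 0)) :
    Tendsto (fun M => μ (⋃ i, A i M)) l (𝓝 0) := by
  have := Fintype.ofFinite ι
  have h1 : Tendsto (fun M => ∑ i, μ (A i M)) l (𝓝 0) := by
    simpa using tendsto_finsetSum Finset.univ fun i _ => h i
  exact tendsto_of_tendsto_of_tendsto_of_le_of_le tendsto_const_nhds h1 (fun _ => zero_le)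
    fun M => measure_iUnion_fintype_le μ _

lemma tendsto_measure_zero_of_subset {Ω κ : Type*} [MeasurableSpace Ω] {μ : Measure Ω}
    {A B : κ → Set Ω} {l : Filter κ} (h : Tendsto (fun M => μ (A M)) l (𝓝 0))
    (hBA : ∀ᶠ M in l, B M ⊆ A M) : Tendsto (fun M => μ (B M)) l (𝓝 0) :=
  tendsto_of_tendsto_of_tendsto_of_le_of_le' tendsto_const_nhds h
    (Eventually.of_forall fun _ => zero_le) (hBA.mono fun _ hM => measure_mono hM)

/-- Dependent random variables with finitely many values: some joint probability is not a
product. -/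
lemma exists_measureReal_ne_of_mutualInfo_pos {Ω S : Type*} [MeasurableSpace Ω] [Countable S]
    [MeasurableSpace S] [MeasurableSingletonClass S] {μ : Measure Ω} [IsProbabilityMeasure μ]
    {X Y : Ω → S} (hX : Measurable X) (hY : Measurable Y) (h : 0 < mutualInfo μ X Y) :
    ∃ a b, μ.real {ω | X ω = a ∧ Y ω = b} ≠ μ.real {ω | X ω = a} * μ.real {ω | Y ω = b} := by
  by_contra! hall
  have := Measure.isProbabilityMeasure_map (μ := μ) hX.aemeasurable
  have := Measure.isProbabilityMeasure_map (μ := μ) hY.aemeasurable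
  have heq : (μ.map fun ω => (X ω, Y ω)) = (μ.map X).prod (μ.map Y) := by
    refine Measure.ext_of_singleton fun ⟨a, b⟩ => ?_
    rw [← Set.singleton_prod_singleton, Measure.prod_prod,
      Measure.map_apply (hX.prodMk hY) (by measurability),
      Measure.map_apply hX (measurableSet_singleton a),
      Measure.map_apply hY (measurableSet_singleton b)]
    have h1 := hall a b
    simp only [measureReal_def, ← ENNReal.toReal_mul] at h1
    have h2 := (ENNReal.toReal_eq_toReal_iff' (measure_ne_top _ _)
      (ENNReal.mul_ne_top (measure_ne_top _ _) (measure_ne_top _ _))).1 h1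
    convert h2 using 2 <;> congr 1
  rw [mutualInfo, heq, InformationTheory.klDiv_self] at h
  exact lt_irrefl _ h

variable {μ : Measure (Data r)} [IsProbabilityMeasure μ] {p : ℕ → Param E base}

lemma measurable_groupProcess (C : G.ConnectedComponent) :
    Measurable fun (x : Data r) (k : ℕ) (u : C.supp) => x u k :=
  measurable_pi_lambda _ fun k => measurable_pi_lambda _ fun u => measurable_sample u k

lemma measurableSet_coord_eq {V : Type*} (u : V) (a : Fin r) :
    MeasurableSet {f : V → Fin r | f u = a} := by
  have : MeasurableSet ((fun f : V → Fin r => f u) ⁻¹' {a}) :=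
    measurable_pi_apply u (measurableSet_singleton a)
  exact this

lemma tendsto_measure_occ {C : G.ConnectedComponent}
    (herg : Ergodic shift (μ.map fun x (k : ℕ) (u : C.supp) => x u k)) (u : C.supp) (a : Fin r)
    {ε : ℝ} (hε : 0 < ε) :
    Tendsto (fun M : ℕ => μ {x | ε ≤ |occ M (x u) a / M - μ.real {x | x u 0 = a}|})
      atTop (𝓝 0) := by
  have h := tendsto_measure_frequency (measurable_groupProcess C) herg
    (B := {f : C.supp → Fin r | f u = a}) (measurableSet_coord_eq u a) hε
  refine h.congr fun M => ?_
  simp only [occ, Set.indicator_apply, Set.mem_ofPred_eq, div_eq_inv_mul]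

lemma tendsto_measure_occ_pair {C : G.ConnectedComponent}
    (herg : Ergodic shift (μ.map fun x (k : ℕ) (u : C.supp) => x u k)) (u v : C.supp) (a b : Fin r)
    {ε : ℝ} (hε : 0 < ε) :
    Tendsto (fun M : ℕ => μ {x | ε ≤ |occ M (fun t => (x u t, x v t)) (a, b) / M
      - μ.real {x | x u 0 = a ∧ x v 0 = b}|}) atTop (𝓝 0) := by
  have h := tendsto_measure_frequency (measurable_groupProcess C) herg
    (B := {f : C.supp → Fin r | f u = a ∧ f v = b})
    ((measurableSet_coord_eq u a).inter
      (measurableSet_coord_eq v b)) hε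
  refine h.congr fun M => ?_
  simp only [occ, Set.indicator_apply, Set.mem_ofPred_eq, div_eq_inv_mul, Prod.mk.injEq]

/-- All states have positive probability. -/
lemma measureReal_sample_pos (hirr : IsIrreducible E) {C : G.ConnectedComponent}
    (herg : Ergodic shift (μ.map fun x (k : ℕ) (u : C.supp) => x u k)) (u : C.supp)
    (hp : p u ∈ paramRange E base)
    (hmc : IsMarkovChain μ (fun k x => x u k) (transMatrix E base (p u))) (a : Fin r) :
    0 < μ.real {x | x u 0 = a} := by
  have hstat : ∀ b t, μ.real {x | x u t = b} = μ.real {x | x u 0 = b} := fun b t =>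
    measureReal_eq_of_ergodic (measurable_groupProcess C) herg
      (B := {f : C.supp → Fin r | f u = b}) (measurableSet_coord_eq u b) t
  -- By stationarity, the probability of `j` at time one is that at time zero, so positivity spreads
  -- along edges; irreducibility then carries it to all states.
  have hstep : ∀ i j, (i, j) ∈ E → 0 < μ.real {x | x u 0 = i} → 0 < μ.real {x | x u 0 = j} := by
    intro i j hij hi
    have h1 := hmc 0 fun k => if k = 0 then i else j
    have h2 : {x : Data r | ∀ k ≤ 0, x u k = if k = 0 then i else j} = {x | x u 0 = i} := by
      ext x; simp
    rw [h2] at h1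
    simp only [zero_add, if_true, one_ne_zero, if_false] at h1
    rw [← hstat j 1]
    refine lt_of_lt_of_le (mul_pos hi (transMatrix_pos hp hij)) (h1 ▸ measureReal_mono ?_)
    intro x hx
    simpa using hx 1 le_rfl
  have hwalk : ∀ k i j, HasWalk E k i j → 0 < μ.real {x | x u 0 = i} →
      0 < μ.real {x | x u 0 = j} := by
    intro k
    induction k with
    | zero => intro i j h hi; exact h ▸ hi
    | succ k ih => rintro i j ⟨l, hl, hw⟩ hi; exact ih l j hw (hstep i l hl hi)
  have hsum : ∑ i : Fin r, μ.real {x : Data r | x u 0 = i} = 1 := by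
    have := sum_measureReal_preimage_singleton (μ := μ) (f := fun x : Data r => x u 0) Finset.univ
      fun a _ => measurable_sample u 0 (measurableSet_singleton a)
    exact this.trans (by simp)
  obtain ⟨i, -, hi⟩ : ∃ i ∈ Finset.univ, 0 < μ.real {x : Data r | x u 0 = i} := by
    by_contra! hneg
    have := Finset.sum_nonpos hneg
    linarith
  obtain ⟨k, hk⟩ := hirr i a
  exact hwalk k i a hk hi

/-- Exceptional counts are excluded by the deviation bound, since `lam` outgrows `√M`; rare visits
by ergodicity, since every state has positive frequency while `eta` is `o(M)`. -/
lemma tendsto_measure_not_rowTest (hirr : IsIrreducible E) {C : G.ConnectedComponent}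
    (herg : Ergodic shift (μ.map fun x (k : ℕ) (u : C.supp) => x u k)) (u : C.supp)
    (hp : p u ∈ paramRange E base)
    (hmc : IsMarkovChain μ (fun k x => x u k) (transMatrix E base (p u)))
    {lam eta : ℕ → ℝ} (hlam : Tendsto (fun M : ℕ => Real.exp (1 - lam M / √M)) atTop (𝓝 0))
    (heta : Tendsto (fun M : ℕ => eta M / M) atTop (𝓝 0)) :
    Tendsto (fun M => μ {x | ¬ RowTest M (lam M) (eta M) (transMatrix E base (p u)) (x u)}) atTop
      (𝓝 0) := by
  have h1 : ∀ ij : Fin r × Fin r, Tendsto (fun M => μ {x : Data r | lam M < |trans M (x u) ij.1 ij.2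
      - occ M (x u) ij.1 * transMatrix E base (p u) ij.1 ij.2|}) atTop (𝓝 0) := by
    intro ij
    have hb : Tendsto (fun M : ℕ => ENNReal.ofReal (2 * Real.exp (1 - lam M / √M))) atTop
        (𝓝 0) := by
      have := ENNReal.tendsto_ofReal (hlam.const_mul 2)
      simpa using this
    refine tendsto_of_tendsto_of_tendsto_of_le_of_le' tendsto_const_nhds hb
      (Eventually.of_forall fun _ => zero_le) ?_
    filter_upwards [eventually_gt_atTop 0] with M hM
    have := hmc.measureReal_trans_sub_occ_le (measurable_sample u) (isStochastic_transMatrix hp)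
      ij.1 ij.2 hM (lam M)
    rw [← ofReal_measureReal]
    exact ENNReal.ofReal_le_ofReal this
  have h2 : ∀ i : Fin r, Tendsto (fun M => μ {x : Data r | occ M (x u) i < eta M}) atTop
      (𝓝 0) := by
    intro i
    have hpos := measureReal_sample_pos hirr herg u hp hmc i
    refine tendsto_measure_zero_of_subset (tendsto_measure_occ herg u i (half_pos hpos)) ?_
    filter_upwards [heta.eventually_lt_const (half_pos hpos), eventually_gt_atTop 0] with M hM hM0
    intro x hx
    have hM0' : (0 : ℝ) < M := by exact_mod_cast hM0
    have hx' : occ M (x u) i < eta M := hx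
    have : occ M (x u) i / M < eta M / M := by gcongr
    rw [Set.mem_ofPred_eq, abs_sub_comm]
    exact le_trans (by linarith) (le_abs_self _)
  refine tendsto_measure_zero_of_subset (tendsto_measure_iUnion_zero (ι := (Fin r × Fin r) ⊕ Fin r)
    (A := Sum.elim (fun ij M => _) (fun i M => _)) (Sum.rec h1 h2)) (Eventually.of_forall ?_)
  intro M x hx
  simp only [Set.mem_ofPred_eq, RowTest, not_forall, not_and_or, not_le] at hx
  obtain ⟨i, j, h | h⟩ := hx
  · exact Set.mem_iUnion.2 ⟨Sum.inl (i, j), h⟩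
  · exact Set.mem_iUnion.2 ⟨Sum.inr i, h⟩

/-- Dependence leaves a fixed gap between some joint probability and the product. The empirical
frequencies converge in measure, so they show this gap, while the threshold tends to zero. -/
lemma tendsto_measure_not_depTest {C : G.ConnectedComponent}
    (herg : Ergodic shift (μ.map fun x (k : ℕ) (u : C.supp) => x u k)) (u v : C.supp)
    (hinfo : 0 < mutualInfo μ (fun x => x u 0) (fun x => x v 0))
    {theta : ℕ → ℝ} (htheta : Tendsto theta atTop (𝓝 0)) :
    Tendsto (fun M => μ {x | ¬ DepTest M (theta M) (x u) (x v)}) atTop (𝓝 0) := by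
  obtain ⟨a, b, hab⟩ := exists_measureReal_ne_of_mutualInfo_pos (measurable_sample u 0)
    (measurable_sample v 0) hinfo
  set J := μ.real {x : Data r | x u 0 = a ∧ x v 0 = b} with hJ
  set A := μ.real {x : Data r | x u 0 = a} with hA
  set B := μ.real {x : Data r | x v 0 = b} with hB
  have hA1 : |A| ≤ 1 := by rw [abs_of_nonneg measureReal_nonneg]; exact measureReal_le_one
  set Δ := |J - A * B| with hΔ
  -- A quarter of the gap for each of the three approximations, and one for the threshold.
  have hΔ0 : 0 < Δ / 4 := by
    have : 0 < Δ := abs_pos.2 (sub_ne_zero.2 hab)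
    linarith
  have h1 := tendsto_measure_occ_pair herg u v a b hΔ0
  have h2 := tendsto_measure_occ herg u a hΔ0
  have h3 := tendsto_measure_occ herg v b hΔ0
  refine tendsto_measure_zero_of_subset (tendsto_measure_iUnion_zero (ι := Unit ⊕ Unit ⊕ Unit)
    (A := Sum.elim (fun _ M => _) (Sum.elim (fun _ M => _) (fun _ M => _)))
    (Sum.rec (fun _ => h1) (Sum.rec (fun _ => h2) (fun _ => h3)))) ?_
  filter_upwards [htheta.eventually_lt_const hΔ0, eventually_gt_atTop 0] with M hM hM0
  intro x hx
  have hM0' : (0 : ℝ) < M := by exact_mod_cast hM0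
  by_contra hnot
  have hnot1 : |occ M (fun t => (x u t, x v t)) (a, b) / M - J| < Δ / 4 := by
    by_contra h
    exact hnot (Set.mem_iUnion.2 ⟨Sum.inl (), not_lt.1 h⟩)
  have hnot2 : |occ M (x u) a / M - A| < Δ / 4 := by
    by_contra h
    exact hnot (Set.mem_iUnion.2 ⟨Sum.inr (Sum.inl ()), not_lt.1 h⟩)
  have hnot3 : |occ M (x v) b / M - B| < Δ / 4 := by
    by_contra h
    exact hnot (Set.mem_iUnion.2 ⟨Sum.inr (Sum.inr ()), not_lt.1 h⟩)
  refine hx ⟨a, b, ?_⟩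
  set o := occ M (fun t => (x u t, x v t)) (a, b)
  set o₁ := occ M (x u) a
  set o₂ := occ M (x v) b
  have hq : |o₂ / M| ≤ 1 := by
    rw [abs_of_nonneg (div_nonneg (occ_nonneg _ _ _) hM0'.le)]
    exact div_le_one_of_le₀ (occ_le _ _ _) hM0'.le
  have e1 : J - A * B = (o / M - o₁ / M * (o₂ / M)) - (o / M - J) + (o₁ / M - A) * (o₂ / M)
      + A * (o₂ / M - B) := by ring
  have e2 : |(o₁ / M - A) * (o₂ / M)| < Δ / 4 := by
    rw [abs_mul]
    exact (mul_le_of_le_one_right (abs_nonneg _) hq).trans_lt hnot2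
  have e3 : |A * (o₂ / M - B)| < Δ / 4 := by
    rw [abs_mul]
    exact (mul_le_of_le_one_left (abs_nonneg _) hA1).trans_lt hnot3
  have e4 : Δ ≤ |o / M - o₁ / M * (o₂ / M)| + |o / M - J| + |(o₁ / M - A) * (o₂ / M)|
      + |A * (o₂ / M - B)| := by
    rw [hΔ, e1]
    refine (abs_add_le _ _).trans (add_le_add ((abs_add_le _ _).trans
      (add_le_add (abs_sub _ _) le_rfl)) le_rfl)
  have e5 : theta M < |o / M - o₁ / M * (o₂ / M)| := by linarith
  have e6 : |o - o₁ * o₂ / M| = |o / M - o₁ / M * (o₂ / M)| * M := by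
    rw [← abs_of_pos hM0', ← abs_mul, abs_of_pos hM0']
    congr 1
    field_simp
  rw [e6]
  gcongr

/-- The true group passes its tests, with probability tending to one. -/
lemma tendsto_measure_not_passes (hirr : IsIrreducible E) {C : G.ConnectedComponent}
    [Finite C.supp]
    (herg : Ergodic shift (μ.map fun x (k : ℕ) (u : C.supp) => x u k))
    (hp : ∀ u, p u ∈ paramRange E base)
    (hmc : ∀ u, IsMarkovChain μ (fun k x => x u k) (transMatrix E base (p u)))
    (hinfo : ∀ u v, G.Adj u v → 0 < mutualInfo μ (fun x => x u 0) (fun x => x v 0))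
    {lam eta theta : ℕ → ℝ}
    (hlam : Tendsto (fun M : ℕ => Real.exp (1 - lam M / √M)) atTop (𝓝 0))
    (heta : Tendsto (fun M : ℕ => eta M / M) atTop (𝓝 0)) (htheta : Tendsto theta atTop (𝓝 0)) :
    Tendsto (fun M => μ {x | ¬ Passes C M (lam M) (eta M) (theta M) (fun u => p u)
      (fun u => x u)}) atTop (𝓝 0) := by
  have h1 : ∀ u : C.supp, _ := fun u =>
    tendsto_measure_not_rowTest hirr herg u (hp u) (hmc u) hlam heta
  have h2 : ∀ uv : {uv : C.supp × C.supp // G.Adj uv.1 uv.2}, _ := fun uv =>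
    tendsto_measure_not_depTest herg uv.1.1 uv.1.2 (hinfo _ _ uv.2) htheta
  refine tendsto_measure_zero_of_subset (tendsto_measure_iUnion_zero
    (ι := C.supp ⊕ {uv : C.supp × C.supp // G.Adj uv.1 uv.2})
    (A := Sum.elim (fun u M => _) (fun uv M => _)) (Sum.rec h1 h2)) (Eventually.of_forall ?_)
  intro M x hx
  simp only [Set.mem_ofPred_eq, Passes, not_and_or, not_forall] at hx
  rcases hx with ⟨u, hu⟩ | ⟨u, v, huv, h⟩
  · exact Set.mem_iUnion.2 ⟨Sum.inl u, hu⟩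
  · exact Set.mem_iUnion.2 ⟨Sum.inr ⟨(u, v), huv⟩, h⟩

/-- As the deviation bound is the same for all transition matrices, a union bound suffices, however
close some parameter vectors are to the boundary of the range. -/
lemma measure_exists_trans_le (hp : ∀ u, p u ∈ paramRange E base)
    (hmc : ∀ u, IsMarkovChain μ (fun k x => x u k) (transMatrix E base (p u)))
    {M : ℕ} (hM : 0 < M) (lam : ℝ) (n : ℕ) :
    μ {x | ∃ u : Fin n, ∃ i j, lam < |trans M (x u) i j
      - occ M (x u) i * transMatrix E base (p u) i j|} ≤
      ENNReal.ofReal (n * (r * r) * (2 * Real.exp (1 - lam / √M))) := by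
  have hsub : {x : Data r | ∃ u : Fin n, ∃ i j, lam < |trans M (x u) i j
      - occ M (x u) i * transMatrix E base (p u) i j|} ⊆
      ⋃ q : Fin n × Fin r × Fin r, {x | lam < |trans M (x q.1) q.2.1 q.2.2
      - occ M (x q.1) q.2.1 * transMatrix E base (p q.1) q.2.1 q.2.2|} := by
    rintro x ⟨u, i, j, h⟩
    exact Set.mem_iUnion.2 ⟨(u, i, j), h⟩
  refine (measure_mono hsub).trans ((measure_iUnion_fintype_le μ _).trans
    ((Finset.sum_le_card_nsmul _ _ (ENNReal.ofReal (2 * Real.exp (1 - lam / √M)))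
      fun q _ => ?_).trans (le_of_eq ?_)))
  · rw [← ofReal_measureReal]
    exact ENNReal.ofReal_le_ofReal ((hmc q.1).measureReal_trans_sub_occ_le (measurable_sample _)
      (isStochastic_transMatrix (hp _)) _ _ hM lam)
  · simp only [Finset.card_univ, Fintype.card_prod, Fintype.card_fin, nsmul_eq_mul]
    rw [← ENNReal.ofReal_natCast, ← ENNReal.ofReal_mul (by positivity)]
    push_cast
    rfl

/-- Two traces from different groups are independent, hence jointly a Markov chain with the product
matrix, and the same deviation bound applies to the pair. -/
lemma measure_exists_trans_pair_le (hp : ∀ u, p u ∈ paramRange E base)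
    (hmc : ∀ u, IsMarkovChain μ (fun k x => x u k) (transMatrix E base (p u)))
    (hind : ∀ u v, ¬ G.Reachable u v → IndepFun (fun x : Data r => x u) (fun x : Data r => x v) μ)
    {M : ℕ} (hM : 0 < M) (lam : ℝ) (n : ℕ) :
    μ {x | ∃ u v : Fin n, ¬ G.Reachable u v ∧ ∃ a b, lam < |trans M (fun t => (x u t, x v t)) a b
      - occ M (fun t => (x u t, x v t)) a *
        pairMatrix (transMatrix E base (p u)) (transMatrix E base (p v)) a b|} ≤
      ENNReal.ofReal (n * n * (r * r * (r * r)) * (2 * Real.exp (1 - lam / √M))) := by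
  have hsub : {x : Data r | ∃ u v : Fin n, ¬ G.Reachable u v ∧ ∃ a b,
      lam < |trans M (fun t => (x u t, x v t)) a b - occ M (fun t => (x u t, x v t)) a *
        pairMatrix (transMatrix E base (p u)) (transMatrix E base (p v)) a b|} ⊆
      ⋃ q : (Fin n × Fin n) × (Fin r × Fin r) × (Fin r × Fin r),
      {x | ¬ G.Reachable q.1.1 q.1.2 ∧
        lam < |trans M (fun t => (x q.1.1 t, x q.1.2 t)) q.2.1 q.2.2
        - occ M (fun t => (x q.1.1 t, x q.1.2 t)) q.2.1 *
        pairMatrix (transMatrix E base (p q.1.1)) (transMatrix E base (p q.1.2)) q.2.1 q.2.2|} := by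
    rintro x ⟨u, v, huv, a, b, h⟩
    exact Set.mem_iUnion.2 ⟨((u, v), a, b), huv, h⟩
  refine (measure_mono hsub).trans ((measure_iUnion_fintype_le μ _).trans
    ((Finset.sum_le_card_nsmul _ _ (ENNReal.ofReal (2 * Real.exp (1 - lam / √M)))
      fun q _ => ?_).trans (le_of_eq ?_)))
  · by_cases hq : G.Reachable q.1.1 q.1.2
    · simp [hq]
    · simp only [hq, not_false_eq_true, true_and]
      rw [← ofReal_measureReal]
      have hpair := (hmc q.1.1).pair (hmc q.1.2) (hind _ _ hq)
      exact ENNReal.ofReal_le_ofReal (hpair.measureReal_trans_sub_occ_le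
        (fun k => (measurable_sample _ k).prodMk (measurable_sample _ k))
        ((isStochastic_transMatrix (hp _)).pairMatrix (isStochastic_transMatrix (hp _))) _ _ hM lam)
  · simp only [Finset.card_univ, Fintype.card_prod, Fintype.card_fin, nsmul_eq_mul]
    rw [← ENNReal.ofReal_natCast, ← ENNReal.ofReal_mul (by positivity)]
    push_cast
    rfl

end Conditional

/-! ### The probability of a failure -/

section Failure

variable {r : ℕ} {E : Finset (Fin r × Fin r)} {base : Fin r → Fin r} {G : SimpleGraph ℕ}

/-- The parameter vectors of the members of `C` are close to those of other users of one group. -/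
def closeGroups (E : Finset (Fin r × Fin r)) (base : Fin r → Fin r) (C : G.ConnectedComponent)
    (o : C.supp) (n : ℕ) (ε : ℝ) : Set (ℕ → Param E base) :=
  {p | ∃ w : C.supp → Fin n, Function.Injective w ∧ (w o : ℕ) ≠ o ∧
    (∀ u v, G.Reachable (w u) (w v)) ∧ ∀ u, dist (p (w u)) (p u) ≤ ε}

lemma measurableSet_closeGroups (C : G.ConnectedComponent) [Finite C.supp] (o : C.supp) (n : ℕ)
    (ε : ℝ) : MeasurableSet (closeGroups E base C o n ε) := by
  refine measurableSet_setOfPred.2 (Measurable.exists fun w => measurable_const.and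
    (measurable_const.and (measurable_const.and (Measurable.forall fun u => ?_))))
  exact measurableSet_setOfPred.1 (measurableSet_le
    ((measurable_pi_apply _).dist (measurable_pi_apply _)) measurable_const)

/-- If `o` lands on another member of `C`, this one close pair already costs `B`. Otherwise the
image lies in a group disjoint from `C`, all pairs consist of different users, and independence
gives the full power of `B`. The image of `o` determines that group, so there are `n` choices for it
and boundedly many for the rest. -/
lemma allLaw_closeGroups_le (f : ParamDensity E base) {C : G.ConnectedComponent} [Fintype C.supp]
    (o : C.supp) (n : ℕ) {ε : ℝ} {B : ℝ≥0∞} (hB : ∀ x, f.law (Metric.closedBall x ε) ≤ B)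
    {S : ℕ} (hS : ∀ C : G.ConnectedComponent, C.supp.encard ≤ S) :
    f.allLaw (closeGroups E base C o n ε) ≤ Fintype.card C.supp * B +
      n * ((S : ℝ≥0∞) ^ Fintype.card C.supp * B ^ Fintype.card C.supp) := by
  classical
  have hfin : ∀ C : G.ConnectedComponent, C.supp.Finite := fun C =>
    Set.finite_of_encard_le_coe (hS C)
  have : ∀ C : G.ConnectedComponent, Fintype C.supp := fun C => (hfin C).fintype
  have hcard : ∀ C : G.ConnectedComponent, Fintype.card C.supp ≤ S := by
    intro C
    have := hS C
    rw [← Set.coe_fintypeCard] at this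
    exact_mod_cast this
  set D₁ : C.supp → Set (ℕ → Param E base) := fun v => {p | v ≠ o ∧ dist (p v) (p o) ≤ ε}
  set D₂ : (v : Fin n) → (C.supp → (G.connectedComponentMk v).supp) → Set (ℕ → Param E base) :=
    fun v w => {p | G.connectedComponentMk v ≠ C ∧ Function.Injective w ∧
      ∀ u, dist (p (w u)) (p u) ≤ ε}
  have hsub : closeGroups E base C o n ε ⊆ (⋃ v, D₁ v) ∪ ⋃ v, ⋃ w, D₂ v w := by
    rintro p ⟨w, hinj, hne, hreach, hdist⟩
    by_cases hC : G.connectedComponentMk (w o) = C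
    · left
      refine Set.mem_iUnion.2 ⟨⟨w o, hC⟩, fun h => hne (congrArg Subtype.val h), hdist o⟩
    · right
      refine Set.mem_iUnion.2 ⟨w o, Set.mem_iUnion.2 ⟨fun u => ⟨w u, ?_⟩, hC, ?_, hdist⟩⟩
      · exact SimpleGraph.ConnectedComponent.eq.2 (hreach u o)
      · intro u v huv
        exact hinj (Fin.ext (congrArg Subtype.val huv))
  have h1 : ∀ v, f.allLaw (D₁ v) ≤ B := by
    intro v
    by_cases hv : v = o
    · simp [D₁, hv]
    · have hinj : Function.Injective (Sum.elim (fun _ : Unit => (o : ℕ)) (fun _ : Unit => (v : ℕ))) := by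
        rintro (a | a) (b | b) h
        · rfl
        · exact absurd (Subtype.ext h) (Ne.symm hv)
        · exact absurd (Subtype.ext h) hv
        · rfl
      have := f.allLaw_dist_le hB _ _ hinj
      simp only [Fintype.card_unit, pow_one] at this
      refine le_trans (measure_mono ?_) this
      intro p hp _
      exact hp.2
  have h2 : ∀ v w, f.allLaw (D₂ v w) ≤ B ^ Fintype.card C.supp := by
    intro v w
    by_cases hv : G.connectedComponentMk v ≠ C ∧ Function.Injective w
    · obtain ⟨hv, hw⟩ := hv
      have hdisj : ∀ u u' : C.supp, (u : ℕ) ≠ w u' := by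
        intro u u' h
        have e1 : G.connectedComponentMk (u : ℕ) = C := u.2
        have e2 : G.connectedComponentMk (w u' : ℕ) = G.connectedComponentMk (v : ℕ) := (w u').2
        exact hv (by rw [← e2, ← h, e1])
      have hinj : Function.Injective (Sum.elim (fun u : C.supp => (u : ℕ))
          (fun u : C.supp => (w u : ℕ))) := by
        rintro (a | a) (b | b) h
        · exact congrArg Sum.inl (Subtype.ext h)
        · exact absurd h (hdisj a b)
        · exact absurd h.symm (hdisj b a)
        · exact congrArg Sum.inr (hw (Subtype.ext h))
      refine le_trans (measure_mono ?_) (f.allLaw_dist_le hB _ _ hinj)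
      intro p hp
      exact hp.2.2
    · have : D₂ v w = ∅ := by
        ext p
        simp only [D₂, Set.mem_ofPred_eq, Set.mem_empty_iff_false, iff_false]
        exact fun h => hv ⟨h.1, h.2.1⟩
      simp [this]
  refine (measure_mono hsub).trans ((measure_union_le _ _).trans (add_le_add ?_ ?_))
  · exact (measure_iUnion_fintype_le _ _).trans
      ((Finset.sum_le_card_nsmul _ _ B fun v _ => h1 v).trans (by simp))
  · refine (measure_iUnion_fintype_le _ _).trans ((Finset.sum_le_card_nsmul _ _
      ((S : ℝ≥0∞) ^ Fintype.card C.supp * B ^ Fintype.card C.supp) fun v _ => ?_).trans (by simp))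
    refine (measure_iUnion_fintype_le _ _).trans ((Finset.sum_le_card_nsmul _ _
      (B ^ Fintype.card C.supp) fun w _ => h2 v w).trans ?_)
    rw [Finset.card_univ, Fintype.card_fun, nsmul_eq_mul]
    push_cast
    gcongr
    exact hcard _

/-- If adjacent members of a group are mapped to users of one group, all members are. -/
lemma reachable_of_forall_adj {C : G.ConnectedComponent} {w : C.supp → ℕ}
    (h : ∀ u v : C.supp, G.Adj u v → G.Reachable (w u) (w v)) (u v : C.supp) :
    G.Reachable (w u) (w v) := by
  have hreach : G.Reachable (u : ℕ) v := SimpleGraph.ConnectedComponent.exact (u.2.trans v.2.symm)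
  obtain ⟨p⟩ := hreach
  have key : ∀ (a b : ℕ) (_ : G.Walk a b) (ha : a ∈ C.supp) (hb : b ∈ C.supp),
      G.Reachable (w ⟨a, ha⟩) (w ⟨b, hb⟩) := by
    intro a b q
    induction q with
    | nil => intro _ _; exact SimpleGraph.Reachable.refl _
    | cons hadj q ih =>
      intro ha hb
      have hc := (C.mem_supp_congr_adj hadj).1 ha
      exact (h ⟨_, ha⟩ ⟨_, hc⟩ hadj).trans (ih hc hb)
  exact key u v p u.2 v.2

/-- A constant that controls the defects of invariance for all pairs of members of a group. -/
lemma exists_pair_constant (hirr : IsIrreducible E) (haper : IsAperiodic E)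
    {C : G.ConnectedComponent} [Finite C.supp] {p : ℕ → Param E base}
    (hp : ∀ u, p u ∈ paramRange E base) :
    ∃ K : ℝ, 0 < K ∧ ∀ u v : C.supp, ∀ (ν : Fin r × Fin r → ℝ) (e : ℝ), ∑ a, ν a = 0 →
      (∀ b, |ν b - ∑ a, ν a *
        pairMatrix (transMatrix E base (p u)) (transMatrix E base (p v)) a b| ≤ e) →
      ∀ b, |ν b| ≤ K * e := by
  have := Fintype.ofFinite C.supp
  -- Aperiodicity provides one walk length for all pairs of states, so the same power of both
  -- factors is positive, and with it that of the product matrix.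
  obtain ⟨N, hN⟩ := exists_forall_hasWalk hirr haper
  have h : ∀ u v : C.supp, _ := fun u v => exists_abs_le_of_vecMul_sub
    (Q := pairMatrix (transMatrix E base (p u)) (transMatrix E base (p v)))
    ((isStochastic_transMatrix (hp u)).pairMatrix (isStochastic_transMatrix (hp v))).row_sum
    (N := N) (by
      intro a b
      rw [pairMatrix_pow]
      exact mul_pos ((hN _ _).transMatrix_pow_pos (hp u)) ((hN _ _).transMatrix_pow_pos (hp v)))
  choose K hK0 hK using h
  refine ⟨1 + ∑ u, ∑ v, K u v, ?_, fun u v ν e hsum he b => (hK u v ν e hsum he b).trans ?_⟩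
  · have : 0 ≤ ∑ u, ∑ v, K u v :=
      Finset.sum_nonneg fun u _ => Finset.sum_nonneg fun v _ => (hK0 u v).le
    linarith
  · have he0 : 0 ≤ e := (abs_nonneg _).trans (he b)
    have h1 : K u v ≤ ∑ v, K u v :=
      Finset.single_le_sum (fun v _ => (hK0 u v).le) (Finset.mem_univ v)
    have h2 : ∑ v, K u v ≤ ∑ u, ∑ v, K u v :=
      Finset.single_le_sum (f := fun u => ∑ v, K u v)
        (fun u _ => Finset.sum_nonneg fun v _ => (hK0 u v).le) (Finset.mem_univ u)
    gcongr
    linarith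

/-- A failure needs that the true group does not pass its tests, or that some transition counts are
exceptional, or that other users have close parameters. -/
lemma mem_closeGroups_of_failure {C : G.ConnectedComponent} {o : C.supp} {n M : ℕ} (hM : 0 < M)
    {lam eta theta K : ℝ} (hlam : 0 ≤ lam) (heta : 0 < eta) {p : ℕ → Param E base} {x : Data r}
    (hp : ∀ u, p u ∈ paramRange E base)
    (hK : ∀ u v : C.supp, ∀ (ν : Fin r × Fin r → ℝ) (e : ℝ), ∑ a, ν a = 0 →
      (∀ b, |ν b - ∑ a, ν a *
        pairMatrix (transMatrix E base (p u)) (transMatrix E base (p v)) a b| ≤ e) →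
      ∀ b, |ν b| ≤ K * e)
    (hsmall : K * ((1 + 2 * r) * (1 + r * r * lam + M * (2 * (2 * lam / eta)))) ≤ theta * M)
    (hfail : (p, x) ∈ failure E base C o n M lam eta theta)
    (htrue : Passes C M lam eta theta (fun u => p u) (fun u => x u))
    (hsingle : ∀ u : Fin n, ∀ i j, |trans M (x u) i j
      - occ M (x u) i * transMatrix E base (p u) i j| ≤ lam)
    (hpair : ∀ u v : Fin n, ¬ G.Reachable u v → ∀ a b,
      |trans M (fun t => (x u t, x v t)) a b - occ M (fun t => (x u t, x v t)) a *
        pairMatrix (transMatrix E base (p u)) (transMatrix E base (p v)) a b| ≤ lam) :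
    p ∈ closeGroups E base C o n (2 * lam / eta) := by
  rcases hfail with hfail | ⟨w, hinj, hne, hpass⟩
  · exact absurd htrue hfail
  -- Both matrices fit the counts of the same trace, in which every state is visited at least `eta`
  -- times.
  have hclose : ∀ u i j, |transMatrix E base (p (w u)) i j - transMatrix E base (p u) i j|
      ≤ 2 * lam / eta := fun u => (hpass.1 u).abs_sub_le heta (hsingle (w u))
  refine ⟨w, hinj, hne, reachable_of_forall_adj (w := fun u => (w u : ℕ)) fun u v huv => ?_,
    fun u => dist_le_of_transMatrix (by positivity) (hclose u)⟩
  -- The traces of `w u` and `w v` would be independent, with matrices close to those of `u` and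
  -- `v`, and could not pass the dependence test. The invariance constant is applied to the matrices
  -- of `u` and `v`, so the fixed group `C` is all that it has to cover.
  by_contra hnot
  exact not_depTest hM (isStochastic_transMatrix (hp u)) (isStochastic_transMatrix (hp v))
    (isStochastic_transMatrix (hp (w u))) (hK u v) (hclose u) (hclose v)
    (hpair (w u) (w v) hnot) hsmall (hpass.2 u v huv)

/-- The conditional probability of a failure tends to zero, when no other users have close
parameters. -/
lemma tendsto_measure_failure {μ : Measure (Data r)} [IsProbabilityMeasure μ]
    {p : ℕ → Param E base} (hirr : IsIrreducible E) (haper : IsAperiodic E)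
    {C : G.ConnectedComponent} [Finite C.supp] (o : C.supp)
    (herg : Ergodic shift (μ.map fun x (k : ℕ) (u : C.supp) => x u k))
    (hp : ∀ u, p u ∈ paramRange E base)
    (hmc : ∀ u, IsMarkovChain μ (fun k x => x u k) (transMatrix E base (p u)))
    (hinfo : ∀ u v, G.Adj u v → 0 < mutualInfo μ (fun x => x u 0) (fun x => x v 0))
    (hind : ∀ u v, ¬ G.Reachable u v → IndepFun (fun x : Data r => x u) (fun x : Data r => x v) μ)
    {lam eta theta : ℕ → ℝ} (hlam0 : ∀ M, 0 < M → 0 ≤ lam M) (heta0 : ∀ M, 0 < M → 0 < eta M)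
    (htheta0 : ∀ M, 0 < M → 0 < theta M)
    (hlam : Tendsto (fun M : ℕ => Real.exp (1 - lam M / √M)) atTop (𝓝 0))
    (heta : Tendsto (fun M : ℕ => eta M / M) atTop (𝓝 0)) (htheta : Tendsto theta atTop (𝓝 0))
    (hratio : Tendsto (fun M : ℕ => (1 + r * r * lam M + M * (2 * (2 * lam M / eta M))) /
      (theta M * M)) atTop (𝓝 0))
    {M : ℕ → ℕ} (hM : Tendsto M atTop atTop)
    (hunion : Tendsto (fun n : ℕ => (n : ℝ) * n * Real.exp (1 - lam (M n) / √(M n))) atTop (𝓝 0)) :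
    Tendsto (fun n => μ {x | (p, x) ∈ failure E base C o n (M n) (lam (M n)) (eta (M n))
      (theta (M n)) ∧ p ∉ closeGroups E base C o n (2 * lam (M n) / eta (M n))}) atTop (𝓝 0) := by
  -- `K` depends on `p` but not on `n`, so `hratio` eventually absorbs it.
  obtain ⟨K, hK0, hK⟩ := exists_pair_constant hirr haper (C := C) hp
  have h1 := (tendsto_measure_not_passes hirr herg hp hmc hinfo hlam heta htheta).comp hM
  have hM0 : ∀ᶠ n in atTop, 0 < M n := hM.eventually_gt_atTop 0
  have h2 : Tendsto (fun n : ℕ => μ {x | ∃ u : Fin n, ∃ i j, lam (M n) < |trans (M n) (x u) i j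
      - occ (M n) (x u) i * transMatrix E base (p u) i j|}) atTop (𝓝 0) := by
    have hb : Tendsto (fun n : ℕ => ENNReal.ofReal (r * r * 2 *
        (n * n * Real.exp (1 - lam (M n) / √(M n))))) atTop (𝓝 0) := by
      simpa using ENNReal.tendsto_ofReal (hunion.const_mul ((r : ℝ) * r * 2))
    refine tendsto_of_tendsto_of_tendsto_of_le_of_le' tendsto_const_nhds hb
      (Eventually.of_forall fun _ => zero_le) ?_
    filter_upwards [hM0, eventually_ge_atTop 1] with n hn hn1
    refine (measure_exists_trans_le hp hmc hn _ n).trans (ENNReal.ofReal_le_ofReal ?_)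
    have hn1' : (1 : ℝ) ≤ n := by exact_mod_cast hn1
    calc (n : ℝ) * (r * r) * (2 * Real.exp (1 - lam (M n) / √(M n)))
        ≤ (n : ℝ) * n * (r * r) * (2 * Real.exp (1 - lam (M n) / √(M n))) := by
          gcongr
          exact le_mul_of_one_le_left (by positivity) hn1'
      _ = _ := by ring
  have h3 : Tendsto (fun n : ℕ => μ {x | ∃ u v : Fin n, ¬ G.Reachable u v ∧ ∃ a b,
      lam (M n) < |trans (M n) (fun t => (x u t, x v t)) a b
      - occ (M n) (fun t => (x u t, x v t)) a *
        pairMatrix (transMatrix E base (p u)) (transMatrix E base (p v)) a b|}) atTop (𝓝 0) := by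
    have hb : Tendsto (fun n : ℕ => ENNReal.ofReal (r * r * (r * r) * 2 *
        (n * n * Real.exp (1 - lam (M n) / √(M n))))) atTop (𝓝 0) := by
      simpa using ENNReal.tendsto_ofReal (hunion.const_mul ((r : ℝ) * r * (r * r) * 2))
    refine tendsto_of_tendsto_of_tendsto_of_le_of_le' tendsto_const_nhds hb
      (Eventually.of_forall fun _ => zero_le) ?_
    filter_upwards [hM0] with n hn
    refine (measure_exists_trans_pair_le hp hmc hind hn _ n).trans (le_of_eq ?_)
    congr 1
    ring
  have hsmall : ∀ᶠ n in atTop, K * ((1 + 2 * r) * (1 + r * r * lam (M n) +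
      M n * (2 * (2 * lam (M n) / eta (M n))))) ≤ theta (M n) * M n := by
    have hc : 0 < 1 / (K * (1 + 2 * r)) := by positivity
    filter_upwards [(hratio.comp hM).eventually_lt_const hc, hM0] with n hn hn0
    have hpos : 0 < theta (M n) * M n := mul_pos (htheta0 _ hn0) (by exact_mod_cast hn0)
    simp only [Function.comp] at hn
    rw [div_lt_div_iff₀ hpos (by positivity), one_mul] at hn
    linarith
  refine tendsto_measure_zero_of_subset (tendsto_measure_iUnion_zero (ι := Unit ⊕ Unit ⊕ Unit)
    (A := Sum.elim (fun _ M => _) (Sum.elim (fun _ M => _) (fun _ M => _)))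
    (Sum.rec (fun _ => h1) (Sum.rec (fun _ => h2) (fun _ => h3)))) ?_
  filter_upwards [hsmall, hM0] with n hn hn0
  rintro x ⟨hfail, hclose⟩
  by_contra hnot
  refine hclose (mem_closeGroups_of_failure hn0 (hlam0 _ hn0) (heta0 _ hn0) hp hK hn hfail ?_ ?_ ?_)
  · by_contra h
    exact hnot (Set.mem_iUnion.2 ⟨Sum.inl (), h⟩)
  · intro u i j
    by_contra h
    exact hnot (Set.mem_iUnion.2 ⟨Sum.inr (Sum.inl ()), u, i, j, not_le.1 h⟩)
  · intro u v huv a b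
    by_contra h
    exact hnot (Set.mem_iUnion.2 ⟨Sum.inr (Sum.inr ()), u, v, huv, a, b, not_le.1 h⟩)

/-- The probability of a failure tends to zero. -/
theorem MarkovModel.tendsto_law_failure (Mo : MarkovModel E base G) (hirr : IsIrreducible E)
    (haper : IsAperiodic E) {S : ℕ} (hS : ∀ C : G.ConnectedComponent, C.supp.encard ≤ S)
    {C : G.ConnectedComponent} [Fintype C.supp] (o : C.supp)
    {lam eta theta : ℕ → ℝ} (hlam0 : ∀ M, 0 < M → 0 ≤ lam M) (heta0 : ∀ M, 0 < M → 0 < eta M)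
    (htheta0 : ∀ M, 0 < M → 0 < theta M)
    (hlam : Tendsto (fun M : ℕ => Real.exp (1 - lam M / √M)) atTop (𝓝 0))
    (heta : Tendsto (fun M : ℕ => eta M / M) atTop (𝓝 0)) (htheta : Tendsto theta atTop (𝓝 0))
    (hratio : Tendsto (fun M : ℕ => (1 + r * r * lam M + M * (2 * (2 * lam M / eta M))) /
      (theta M * M)) atTop (𝓝 0))
    {M : ℕ → ℕ} (hM : Tendsto M atTop atTop)
    (hunion : Tendsto (fun n : ℕ => (n : ℝ) * n * Real.exp (1 - lam (M n) / √(M n))) atTop (𝓝 0))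
    (hball : Tendsto (fun n => (2 * lam (M n) / eta (M n)) ^ Fintype.card (FreeEdge E base)) atTop
      (𝓝 0))
    (hcount : Tendsto (fun n : ℕ => n * ((2 * lam (M n) / eta (M n)) ^
      Fintype.card (FreeEdge E base)) ^ Fintype.card C.supp) atTop (𝓝 0)) :
    Tendsto (fun n => Mo.law (failure E base C o n (M n) (lam (M n)) (eta (M n)) (theta (M n))))
      atTop (𝓝 0) := by
  set F : ℕ → Set ((ℕ → Param E base) × Data r) := fun n =>
    failure E base C o n (M n) (lam (M n)) (eta (M n)) (theta (M n)) with hF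
  set D : ℕ → Set (ℕ → Param E base) := fun n =>
    closeGroups E base C o n (2 * lam (M n) / eta (M n)) with hD
  set ε : ℕ → ℝ := fun n => 2 * lam (M n) / eta (M n) with hε
  set d := Fintype.card (FreeEdge E base)
  set s := Fintype.card C.supp
  have hFm : ∀ n, MeasurableSet (F n) := fun n => measurableSet_failure C o n _ _ _ _
  have hDm : ∀ n, MeasurableSet (D n) := fun n => measurableSet_closeGroups C o n _
  have hDm' : ∀ n, MeasurableSet ((Prod.fst : (ℕ → Param E base) × Data r → _) ⁻¹' D n) :=
    fun n => measurable_fst (hDm n)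
  have hM0 : ∀ᶠ n in atTop, 0 < M n := hM.eventually_gt_atTop 0
  have hclose : Tendsto (fun n => Mo.prior.allLaw (D n)) atTop (𝓝 0) := by
    obtain ⟨δ, hδ0, hδ⟩ := Mo.prior.exists_law_closedBall_le
    have hb1 : Tendsto (fun n => (s : ℝ≥0∞) * ENNReal.ofReal (δ * ε n ^ d)) atTop (𝓝 0) := by
      have := ENNReal.Tendsto.const_mul (a := (s : ℝ≥0∞))
        (ENNReal.tendsto_ofReal (hball.const_mul δ)) (Or.inr (ENNReal.natCast_ne_top s))
      simpa using this
    have hb2 : Tendsto (fun n : ℕ => ENNReal.ofReal (S ^ s * δ ^ s * (n * (ε n ^ d) ^ s))) atTop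
        (𝓝 0) := by
      simpa using ENNReal.tendsto_ofReal (hcount.const_mul ((S : ℝ) ^ s * δ ^ s))
    have hb := hb1.add hb2
    rw [add_zero] at hb
    refine tendsto_of_tendsto_of_tendsto_of_le_of_le' tendsto_const_nhds hb
      (Eventually.of_forall fun _ => zero_le) ?_
    filter_upwards [hM0] with n hn
    have hε0 : 0 ≤ ε n := div_nonneg (mul_nonneg zero_le_two (hlam0 _ hn)) (heta0 _ hn).le
    refine (allLaw_closeGroups_le Mo.prior o n (fun x => hδ x (ε n) hε0) hS).trans
      (add_le_add le_rfl (le_of_eq ?_))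
    have hx : 0 ≤ δ * ε n ^ d := by positivity
    rw [← ENNReal.ofReal_pow hx, ← ENNReal.ofReal_natCast S, ← ENNReal.ofReal_natCast n,
      ← ENNReal.ofReal_pow (by positivity), ← ENNReal.ofReal_mul (by positivity),
      ← ENNReal.ofReal_mul (by positivity)]
    congr 1
    rw [mul_pow]
    ring
  have hrest : Tendsto (fun n => Mo.law (F n \ Prod.fst ⁻¹' D n)) atTop (𝓝 0) := by
    -- The conditional probabilities vanish for almost every `p`, without a uniform rate; dominated
    -- convergence with the bound one is enough.
    have hlim : Tendsto (fun n => ∫⁻ p, Mo.dataLaw p (Prod.mk p ⁻¹' (F n \ Prod.fst ⁻¹' D n))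
        ∂Mo.prior.allLaw) atTop (𝓝 (∫⁻ _, 0 ∂Mo.prior.allLaw)) := by
      refine tendsto_lintegral_of_dominated_convergence (fun _ => 1) (fun n =>
        Kernel.measurable_kernel_prodMk_left ((hFm n).diff (hDm' n)))
        (fun n => Eventually.of_forall fun p => prob_le_one) (by simp) ?_
      filter_upwards [Mo.isMarkovChain, Mo.ergodic, Mo.mutualInfo_pos, Mo.indepFun,
        Mo.prior.ae_mem_paramRange] with p hmc herg hinfo hind hp
      exact tendsto_measure_failure hirr haper o (herg C) hp hmc (fun u v huv => hinfo u v huv 0)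
        hind hlam0 heta0 htheta0 hlam heta htheta hratio hM hunion
    rw [lintegral_zero] at hlim
    refine hlim.congr fun n => ?_
    rw [MarkovModel.law, Measure.compProd_apply ((hFm n).diff (hDm' n))]
  have hfst : ∀ n, Mo.law (Prod.fst ⁻¹' D n) = Mo.prior.allLaw (D n) := by
    intro n
    rw [← Measure.map_apply measurable_fst (hDm n)]
    change (Mo.prior.allLaw.compProd Mo.dataLaw).fst (D n) = _
    rw [Measure.fst_compProd]
  have hsum := hrest.add hclose
  rw [add_zero] at hsum
  refine tendsto_of_tendsto_of_tendsto_of_le_of_le tendsto_const_nhds hsum (fun _ => zero_le)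
    fun n => ?_
  change Mo.law (F n) ≤ _
  rw [← hfst]
  refine (measure_mono ?_).trans (measure_union_le _ _)
  intro ω hω
  by_cases h : ω.1 ∈ D n
  · exact Or.inr h
  · exact Or.inl ⟨hω, h⟩

end Failure

/-! ### The choice of the thresholds -/

section Asymptotics

lemma tendsto_natCast_rpow_neg {a : ℝ} (ha : a < 0) :
    Tendsto (fun M : ℕ => (M : ℝ) ^ a) atTop (𝓝 0) := by
  have := (tendsto_rpow_neg_atTop (y := -a) (by linarith)).comp
    (tendsto_natCast_atTop_atTop (R := ℝ))
  simpa [Function.comp_def] using this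

lemma tendsto_natCast_rpow_mul_exp {a δ : ℝ} (hδ : 0 < δ) :
    Tendsto (fun M : ℕ => (M : ℝ) ^ a * Real.exp (1 - (M : ℝ) ^ δ)) atTop (𝓝 0) := by
  -- In the variable `M ^ δ`, the factor `M ^ a` has exponent `a / δ`.
  have h1 := (tendsto_rpow_mul_exp_neg_mul_atTop_nhds_zero (a / δ) 1 one_pos).comp
    ((tendsto_rpow_atTop hδ).comp (tendsto_natCast_atTop_atTop (R := ℝ)))
  have h2 := h1.const_mul (Real.exp 1)
  rw [mul_zero] at h2
  refine h2.congr fun M => ?_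
  simp only [Function.comp]
  rw [← Real.rpow_mul (Nat.cast_nonneg M), mul_div_cancel₀ _ hδ.ne', sub_eq_add_neg, Real.exp_add]
  ring_nf

lemma rpow_half_add_div_sqrt {M : ℕ} (hM : 0 < M) (δ : ℝ) :
    (M : ℝ) ^ (1 / 2 + δ) / √M = (M : ℝ) ^ δ := by
  have hM' : (0 : ℝ) < M := by exact_mod_cast hM
  rw [Real.sqrt_eq_rpow, ← Real.rpow_sub hM']
  congr 1; ring

lemma rpow_half_add_div_rpow {M : ℕ} (hM : 0 < M) (δ : ℝ) :
    2 * (M : ℝ) ^ (1 / 2 + δ) / (M : ℝ) ^ (1 - δ) = 2 * (M : ℝ) ^ (-(1 / 2) + 2 * δ) := by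
  have hM' : (0 : ℝ) < M := by exact_mod_cast hM
  rw [mul_div_assoc, ← Real.rpow_sub hM']
  congr 2; ring

/-- The growth of the number of observations, solved for the number of users. -/
lemma eventually_le_const_mul_rpow {c β : ℝ} (hc : 0 < c) (hβ : 0 < β) {m : ℕ → ℕ}
    (hm : Tendsto (fun n : ℕ => (m n : ℝ) / (n : ℝ) ^ β) atTop (𝓝 c)) :
    Tendsto (fun n => m n - 1) atTop atTop ∧
      ∃ A : ℝ, 0 < A ∧ ∀ᶠ n : ℕ in atTop, (n : ℝ) ≤ A * ((m n - 1 : ℕ) : ℝ) ^ (1 / β) := by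
  have hlow : ∀ᶠ n : ℕ in atTop, c / 2 * (n : ℝ) ^ β < m n := by
    filter_upwards [hm.eventually_const_lt (half_lt_self hc), eventually_gt_atTop 0] with n hn hn0
    have : (0 : ℝ) < (n : ℝ) ^ β := Real.rpow_pos_of_pos (by exact_mod_cast hn0) _
    rwa [lt_div_iff₀ this] at hn
  have hminf : Tendsto m atTop atTop := by
    rw [← tendsto_natCast_atTop_iff (R := ℝ)]
    refine tendsto_atTop_mono' _ (hlow.mono fun n hn => hn.le) ?_
    exact ((tendsto_rpow_atTop hβ).comp tendsto_natCast_atTop_atTop).const_mul_atTop (half_pos hc)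
  -- In `4 / c`, one factor two comes from `hlow` and the other from `m ≤ 2 * (m - 1)`.
  refine ⟨(tendsto_sub_atTop_nat 1).comp hminf, (4 / c) ^ (1 / β), by positivity, ?_⟩
  filter_upwards [hlow, hminf.eventually_ge_atTop 2] with n hn hm2
  have h1 : (m n : ℝ) ≤ 2 * ((m n - 1 : ℕ) : ℝ) := by
    have : m n ≤ 2 * (m n - 1) := by omega
    exact_mod_cast this
  have h2 : (n : ℝ) ^ β ≤ 4 / c * ((m n - 1 : ℕ) : ℝ) := by
    rw [div_mul_eq_mul_div, le_div_iff₀ hc]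
    linarith
  calc (n : ℝ) = ((n : ℝ) ^ β) ^ (1 / β) := by
        rw [← Real.rpow_mul (Nat.cast_nonneg n), mul_one_div_cancel hβ.ne', Real.rpow_one]
    _ ≤ (4 / c * ((m n - 1 : ℕ) : ℝ)) ^ (1 / β) := by gcongr
    _ = _ := Real.mul_rpow (by positivity) (Nat.cast_nonneg _)

variable {r : ℕ} {E : Finset (Fin r × Fin r)} {base : Fin r → Fin r} {G : SimpleGraph ℕ}

/-- With these thresholds, the probability of a failure tends to zero when the number of
observations grows fast enough. -/
theorem MarkovModel.tendsto_law_failure_rpow (Mo : MarkovModel E base G) (hirr : IsIrreducible E)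
    (haper : IsAperiodic E) {S : ℕ} (hS : ∀ C : G.ConnectedComponent, C.supp.encard ≤ S)
    {C : G.ConnectedComponent} [Fintype C.supp] (o : C.supp)
    (hd : 0 < Fintype.card (FreeEdge E base)) {β δ A : ℝ} (hδ : 0 < δ)
    (hδ' : δ ≤ 1 / 12) (hβδ : 1 / β < Fintype.card C.supp * Fintype.card (FreeEdge E base) *
      (1 / 2 - 2 * δ)) {M : ℕ → ℕ} (hM : Tendsto M atTop atTop)
    (hA : ∀ᶠ n : ℕ in atTop, (n : ℝ) ≤ A * (M n : ℝ) ^ (1 / β)) :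
    Tendsto (fun n => Mo.law (failure E base C o n (M n) ((M n : ℝ) ^ (1 / 2 + δ))
      ((M n : ℝ) ^ (1 - δ)) ((M n : ℝ) ^ (-δ)))) atTop (𝓝 0) := by
  set d := Fintype.card (FreeEdge E base)
  set s := Fintype.card C.supp
  have hM0 : ∀ᶠ n in atTop, 0 < M n := hM.eventually_gt_atTop 0
  refine Mo.tendsto_law_failure hirr haper hS o (lam := fun M => (M : ℝ) ^ (1 / 2 + δ))
    (eta := fun M => (M : ℝ) ^ (1 - δ)) (theta := fun M => (M : ℝ) ^ (-δ)) (fun M _ => by positivity)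
    (fun M hM => by positivity) (fun M hM => by positivity) ?_ ?_ ?_ ?_ hM ?_ ?_ ?_
  · have h := tendsto_natCast_rpow_mul_exp (a := 0) hδ
    refine h.congr' ?_
    filter_upwards [eventually_gt_atTop 0] with M hM
    rw [rpow_half_add_div_sqrt hM, Real.rpow_zero, one_mul]
  · refine (tendsto_natCast_rpow_neg (neg_lt_zero.2 hδ)).congr' ?_
    filter_upwards [eventually_gt_atTop 0] with M hM
    have hM' : (0 : ℝ) < M := by exact_mod_cast hM
    nth_rewrite 3 [← Real.rpow_one (M : ℝ)]
    rw [← Real.rpow_sub hM']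
    congr 1; ring
  · exact tendsto_natCast_rpow_neg (neg_lt_zero.2 hδ)
  -- The three terms of the ratio have orders `M ^ (δ - 1)`, `M ^ (-1/2 + 2δ)` and `M ^ (-1/2 +
  -- 3δ)`; the bound on `δ` makes all exponents negative.
  · have h1 := tendsto_natCast_rpow_neg (a := δ - 1) (by linarith)
    have h2 := (tendsto_natCast_rpow_neg (a := -(1 / 2) + 2 * δ) (by linarith)).const_mul
      ((r : ℝ) * r)
    have h3 := (tendsto_natCast_rpow_neg (a := -(1 / 2) + 3 * δ) (by linarith)).const_mul 4
    have h := (h1.add h2).add h3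
    simp only [mul_zero, add_zero] at h
    refine h.congr' ?_
    filter_upwards [eventually_gt_atTop 0] with M hM
    have hM' : (0 : ℝ) < M := by exact_mod_cast hM
    have e0 : (M : ℝ) ^ (-δ) * M = (M : ℝ) ^ (1 - δ) := by
      nth_rewrite 2 [← Real.rpow_one (M : ℝ)]
      rw [← Real.rpow_add hM']
      congr 1; ring
    have e1 : (M : ℝ) ^ (δ - 1) * (M : ℝ) ^ (1 - δ) = 1 := by
      rw [← Real.rpow_add hM', ← Real.rpow_zero (M : ℝ)]
      congr 1; ring
    have e2 : (M : ℝ) ^ (-(1 / 2) + 2 * δ) * (M : ℝ) ^ (1 - δ) = (M : ℝ) ^ (1 / 2 + δ) := by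
      rw [← Real.rpow_add hM']
      congr 1; ring
    have e3 : (M : ℝ) ^ (-(1 / 2) + 3 * δ) * (M : ℝ) ^ (1 - δ)
        = (M : ℝ) * (M : ℝ) ^ (-(1 / 2) + 2 * δ) := by
      nth_rewrite 3 [← Real.rpow_one (M : ℝ)]
      rw [← Real.rpow_add hM', ← Real.rpow_add hM']
      congr 1; ring
    rw [rpow_half_add_div_rpow hM, e0, eq_div_iff (by positivity)]
    linear_combination e1 + (r : ℝ) * r * e2 + 4 * e3
  -- `n` is at most a power of `M`, so the stretched exponential beats the number of pairs.
  · have h := ((tendsto_natCast_rpow_mul_exp (a := 1 / β + 1 / β) hδ).comp hM).const_mul (A * A)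
    rw [mul_zero] at h
    refine tendsto_of_tendsto_of_tendsto_of_le_of_le' tendsto_const_nhds h
      (Eventually.of_forall fun n => by positivity) ?_
    filter_upwards [hM0, hA] with n hn hnA
    have hn' : (0 : ℝ) < M n := by exact_mod_cast hn
    simp only [Function.comp]
    rw [rpow_half_add_div_sqrt hn, Real.rpow_add hn']
    calc _ ≤ (A * (M n : ℝ) ^ (1 / β)) * (A * (M n : ℝ) ^ (1 / β)) *
          Real.exp (1 - (M n : ℝ) ^ δ) := by
          gcongr
          exact (Nat.cast_nonneg n).trans hnA
      _ = _ := by ring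
  · have h := (((tendsto_natCast_rpow_neg (a := -(1 / 2) + 2 * δ) (by linarith)).const_mul
      2).comp hM).pow d
    rw [mul_zero, zero_pow hd.ne'] at h
    refine h.congr' ?_
    filter_upwards [hM0] with n hn
    rw [rpow_half_add_div_rpow hn]
    rfl
  -- The expected number of close groups is at most of this order; `hβδ` says that the exponent is
  -- negative. Here the threshold `2 / (s * d)` is decided.
  · have h := ((tendsto_natCast_rpow_neg (a := 1 / β + (-(1 / 2) + 2 * δ) * (d * s))
      (by linarith)).comp hM).const_mul (A * 2 ^ (d * s))
    rw [mul_zero] at h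
    refine tendsto_of_tendsto_of_tendsto_of_le_of_le' tendsto_const_nhds h
      (Eventually.of_forall fun n => by positivity) ?_
    filter_upwards [hM0, hA] with n hn hnA
    have hn' : (0 : ℝ) < M n := by exact_mod_cast hn
    simp only [Function.comp]
    have e : (M n : ℝ) ^ (1 / β + (-(1 / 2) + 2 * δ) * (d * s))
        = (M n : ℝ) ^ (1 / β) * ((M n : ℝ) ^ (-(1 / 2) + 2 * δ)) ^ (d * s) := by
      rw [Real.rpow_add hn', Real.rpow_mul hn'.le, ← Nat.cast_mul, Real.rpow_natCast]
    rw [rpow_half_add_div_rpow hn, ← pow_mul, mul_pow, e]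
    calc _ ≤ (A * (M n : ℝ) ^ (1 / β)) *
          (2 ^ (d * s) * ((M n : ℝ) ^ (-(1 / 2) + 2 * δ)) ^ (d * s)) := by gcongr
      _ = _ := by ring

end Asymptotics

end AnonMarkov

end

/-! ### The main theorem. -/

open AnonMarkov in
theorem mainTheorem6 {r : ℕ} (hr : 2 ≤ r) (E : Finset (Fin r × Fin r))
    (hirr : AnonMarkov.IsIrreducible E) (haper : AnonMarkov.IsAperiodic E)
    (base : Fin r → Fin r) (hbase : ∀ i, (i, base i) ∈ E)
    (G : SimpleGraph ℕ) (hG : ∃ S : ℕ, ∀ C : G.ConnectedComponent, C.supp.encard ≤ S)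
    (s : ℕ) (hs : (G.connectedComponentMk 0).supp.encard = s)
    (c α : ℝ) (hc : 0 < c) (hα : 0 < α) (m : ℕ → ℕ)
    (hm : Tendsto (fun n : ℕ => (m n : ℝ) / (n : ℝ) ^ (2 / (s * ((E.card : ℝ) - r)) + α))
      atTop (𝓝 c)) :
    ∃ A : (n : ℕ) → ℕ → AnonMarkov.Estimator E base n (m n),
      ∀ (M : AnonMarkov.MarkovModel E base G) (τ : (n : ℕ) → PMF (Equiv.Perm (Fin n))),
        (∀ k, Tendsto (fun n => AnonMarkov.errorProb M (τ n) 0 k (A n k)) atTop (𝓝 0)) ∧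
        AnonMarkov.NoPrivacy M m τ 0 := by
  obtain ⟨S, hS⟩ := hG
  set C := G.connectedComponentMk 0 with hC
  have hfin : C.supp.Finite := Set.finite_of_encard_eq_coe hs
  have : Fintype C.supp := hfin.fintype
  have hcard : Fintype.card C.supp = s := by
    rw [← Set.coe_fintypeCard] at hs
    exact_mod_cast hs
  let o : C.supp := ⟨0, hC.symm⟩
  have hspos : 0 < s := hcard ▸ Fintype.card_pos_iff.2 ⟨o⟩
  set d := Fintype.card (FreeEdge E base) with hd
  have hdE : d + r = E.card := card_freeEdge hbase
  -- With no free parameter, closeness of parameters would be no restriction at all.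
  have hdpos : 0 < d := by
    have := card_lt_card_of_isAperiodic hr hirr haper hbase
    omega
  have hdE' : (E.card : ℝ) - r = d := by
    rw [← hdE]; push_cast; ring
  rw [hdE'] at hm
  have hs' : (0 : ℝ) < s := by exact_mod_cast hspos
  have hd' : (0 : ℝ) < d := by exact_mod_cast hdpos
  set β : ℝ := 2 / (s * d) + α with hβ
  have hβpos : 0 < β := by positivity
  -- In terms of the number of observations, `n` grows at most like the power `1 / β`; `α > 0` makes
  -- the inequality strict and leaves room for `δ`.
  have hgap : 1 / β < s * d / 2 := by
    have h1 : 2 / ((s : ℝ) * d) < β := by rw [hβ]; linarith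
    have h2 := one_div_lt_one_div_of_lt (by positivity) h1
    rwa [one_div_div] at h2
  -- The second entry lets the loss `2 * δ * (s * d)` use up at most half of the gap.
  set δ : ℝ := min (1 / 12) ((s * d / 2 - 1 / β) / (4 * (s * d))) with hδdef
  have hδ : 0 < δ := lt_min (by norm_num) (div_pos (by linarith) (by positivity))
  have hβδ : 1 / β < s * d * (1 / 2 - 2 * δ) := by
    have h1 : δ ≤ (s * d / 2 - 1 / β) / (4 * (s * d)) := min_le_right _ _
    rw [le_div_iff₀ (by positivity)] at h1
    linarith
  obtain ⟨hMtop, B, hB, hnB⟩ := eventually_le_const_mul_rpow hc hβpos hm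
  let y : Fin r := ⟨0, by omega⟩
  let A : (n : ℕ) → ℕ → Estimator E base n (m n) := fun n k =>
    ⟨groupEstimate C o y (((m n - 1 : ℕ) : ℝ) ^ (1 / 2 + δ)) (((m n - 1 : ℕ) : ℝ) ^ (1 - δ))
      (((m n - 1 : ℕ) : ℝ) ^ (-δ)) k, measurable_groupEstimate C o y _ _ _ k⟩
  refine ⟨A, fun M τ => ?_⟩
  have hfail := M.tendsto_law_failure_rpow hirr haper hS o hdpos hδ (min_le_left _ _)
    (by rw [hcard]; exact hβδ) hMtop hnB
  have herr : ∀ k, Tendsto (fun n => errorProb M (τ n) 0 k (A n k)) atTop (𝓝 0) := by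
    intro k
    refine tendsto_of_tendsto_of_tendsto_of_le_of_le' tendsto_const_nhds hfail
      (Eventually.of_forall fun _ => zero_le) ?_
    -- The group is finite, so eventually all its members are among the `n` users.
    obtain ⟨N, hN⟩ := hfin.bddAbove
    filter_upwards [hMtop.eventually_ge_atTop k, hMtop.eventually_gt_atTop 0,
      eventually_gt_atTop N] with n hnk hn0 hnN
    have hle : ∀ π : Equiv.Perm (Fin n), M.law {ω | (A n k).1 (fun v : Fin n => ω.1 v,
        anonymize (m n) π ω.2) ≠ ω.2 0 k} ≤ M.law (failure E base C o n (m n - 1)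
          (((m n - 1 : ℕ) : ℝ) ^ (1 / 2 + δ)) (((m n - 1 : ℕ) : ℝ) ^ (1 - δ))
          (((m n - 1 : ℕ) : ℝ) ^ (-δ))) := fun π =>
      measure_mono fun ω hω => mem_failure_of_groupEstimate_ne (u := o) (by omega)
        (fun v => (hN v.2).trans_lt hnN) π hω
    calc errorProb M (τ n) 0 k (A n k) ≤ ∑ π : Equiv.Perm (Fin n), τ n π * _ :=
          Finset.sum_le_sum fun π _ => mul_le_mul_right (hle π) _
      _ = _ := by
          have hτ : ∑ π, τ n π = 1 := by simpa [tsum_fintype] using (τ n).tsum_coe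
          rw [← Finset.sum_mul, hτ, one_mul]
  refine ⟨herr, fun k => ?_⟩
  exact tendsto_of_tendsto_of_tendsto_of_le_of_le tendsto_const_nhds (herr k)
    (fun _ => zero_le) fun n => iInf_le _ (A n k)
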